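/- **Setting.** Call a function $F$ a *stable* transfer function if there are $\varepsilon>0$ and a real signed Borel measure $\mu$ on $[0,\infty)$ (the impulse response) with $\int e^{\varepsilon t}\,d|\mu|(t)<\infty$ such that $F(s)=\int_{[0,\infty)}e^{-st}\,d\mu(t)$ for $\operatorname{Re}s\ge 0$, $s\neq 0$; in particular $F$ is proper and has no poles in the closed right half-plane. Consider a channel of $N\ge 1$ pools with transfer functions $G^{\rm in}_n,G^{\rm out}_n$ ($1\le n\le N$) from inflow and outflow to downstream water level. Each is proper with one integrator and no other unstable poles: for some storage capacity $c_n>0$, both $G^{\rm in}_n(s)-\frac{1}{c_n s}$ and $G^{\rm out}_n(s)+\frac1{c_n s}$ are stable. With gate flows $u_1,\dots,u_{N-1}$, disturbances $d_0$ (top inflow), $d_1,\dots,d_N$ (off-takes), $d_{N+1}$ (bottom outflow), and $y_n$ the level deviation in pool $n+1$ minus that in pool $n$, one has $\hat y=G\hat u+G^d\hat d$, where $G$ is the $(N-1)\times(N-1)$ matrix with $$G_{n,n}=G^{\rm in}_{n+1}-G^{\rm out}_n,\quad G_{n,n+1}=G^{\rm out}_{n+1},\quad G_{n,n-1}=-G^{\rm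 in}_n,$$ and $G^d$ is the $(N-1)\times(N+2)$ matrix with $$G^d_{1,1}=-G^{\rm in}_1,\quad G^d_{n,n+1}=-G^{\rm out}_n,\quad G^d_{n,n+2}=G^{\rm out}_{n+1},\quad G^d_{N-1,N+2}=G^{\rm out}_N,$$ all other entries being zero. Let $\nu=(\nu_1,\dots,\nu_{N-1})$ be a permutation of $\{1,\dots,N-1\}$ (the design order). Given compensators $C_{\nu_1},\dots,C_{\nu_{m-1}}$, put $\underline\nu=(\nu_1,\dots,\nu_{m-1})$ and $C_{\underline\nu}=\operatorname{diag}(C_{\nu_1},\dots,C_{\nu_{m-1}})$, let $\tilde G^{[m]}$ be $G$ with the columns in $\underline\nu$ replaced by zero, and let $G^{[m]}$ be the $(\nu_m,\nu_m)$ entry of $$H^{[m]}=\tilde G^{[m]}+G_{\bullet,\underline\nu}\,C_{\underline\nu}\,\bigl(I-G_{\underline\nu,\underline\nu}C_{\underline\nu}\bigr)^{-1}\tilde G^{[m]}_{\underline\nu,\bullet},$$ i.e. the transfer function from $\hat u_{\nu_m}$ to $\hat y_{\nu_m}$ with the loops $\hat u_{\nu_p}=C_{\nu_p}\hat y_{\nu_p}$,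 $p<m$, closed. Compensators are of the form $$C(s)=-K^p\Bigl(1+\frac{1}{T^I s}\Bigr)\frac{1}{1+T^F s},\qquad K^p,T^I,T^F>0. \tag{1}$$ $C$ *stabilizes* $P$ if $1-PC$ has no zeros in $\{\operatorname{Re}s\ge0,\ s\ne0\}$ and $(1-PC)^{-1}$, $P(1-PC)^{-1}$, $C(1-PC)^{-1}$ are stable. The loop has *phase margin* $\phi$ degrees if there is exactly one $\omega_c>0$ with $|P(i\omega_c)C(i\omega_c)|=1$, and $-P(i\omega_c)C(i\omega_c)$ has phase $-180+\phi$ degrees. **Theorem.** Let $\nu$ be any design order and $\phi_{\rm PM}\in(0,90)$. (a) For every step $m\in\{1,\dots,N-1\}$, and whatever compensators $C_{\nu_1},\dots,C_{\nu_{m-1}}$ of the form (1) were chosen before such that $C_{\nu_p}$ stabilizes $G^{[p]}$ for all $p<m$, there is a compensator $C_{\nu_m}$ of the form (1) that stabilizes $G^{[m]}$ with phase margin $\phi_{\rm PM}$ degrees. (b) Whenever $C_1,\dots,C_{N-1}$ are of the form (1) and $C_{\nu_m}$ stabilizes $G^{[m]}$ for every $m$, then, with $C=\operatorname{diag}(C_1,\dots,C_{N-1})$,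 the matrix $I-G(s)C(s)$ is invertible for $\operatorname{Re}s\ge0$, $s\neq0$, and every entry of the MIMO closed loop $(I-GC)^{-1}G^d$ is stable. Moreover, for every constant disturbance $d\in\mathbb R^{N+2}$ switched on at $t=0$, the output $y$, i.e. the unique right-continuous function on $[0,\infty)$ with Laplace transform $\hat y(s)=(I-G(s)C(s))^{-1}G^d(s)\,d/s$, exists and satisfies $$\lim_{t\to\infty}y(t)=\lim_{s\to0,\ \operatorname{Re}s>0}s\,\hat y(s)=0.$$ -/

import Mathlib

open MeasureTheory Filter Topology Set

noncomputable section

namespace Channel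

/-- Stable (possibly distributed-parameter) real transfer function: the impulse response is a real
signed Borel measure `μ₁ - μ₂` on `[0, ∞)` with `∫ exp (ε t) d(μ₁ + μ₂) < ∞` for some `ε > 0`, and
`F` is its Laplace transform on the closed right half-plane. Hence `F` continues analytically and
boundedly to `re s > -ε`: it is proper and has no poles in the closed right half-plane. The point
`s = 0`, where pointwise formulas such as `1 / s` take a junk value, is left out. -/
def Stable (F : ℂ → ℂ) : Prop :=
  ∃ (μ₁ μ₂ : Measure ℝ) (ε : ℝ), 0 < ε ∧ μ₁ (Iio 0) = 0 ∧ μ₂ (Iio 0) = 0 ∧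
    Integrable (fun t : ℝ => Real.exp (ε * t)) μ₁ ∧
    Integrable (fun t : ℝ => Real.exp (ε * t)) μ₂ ∧
    ∀ s : ℂ, 0 ≤ s.re → s ≠ 0 →
      F s = (∫ t : ℝ, Complex.exp (-s * (t : ℂ)) ∂μ₁) - ∫ t : ℝ, Complex.exp (-s * (t : ℂ)) ∂μ₂

/-- `F` is proper and, apart from an integrator with gain `g` (a pole at `s = 0` that is at most
simple, with residue `g`), has no poles in the closed right half-plane. -/
def HasIntegrator (F : ℂ → ℂ) (g : ℝ) : Prop :=
  Stable (fun s => F s - (g : ℂ) / s)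

/-- Transfer matrix from the `n` gate flows to the `n` level-error differences, for `n + 1` pools.
Gate `i` lies between pool `i.castSucc` (upstream) and pool `i.succ` (downstream). -/
def plant {n : ℕ} (Gin Gout : Fin (n + 1) → ℂ → ℂ) (s : ℂ) : Matrix (Fin n) (Fin n) ℂ :=
  Matrix.of fun i j =>
    if j = i then Gin i.succ s - Gout i.castSucc s
    else if (j : ℕ) = i + 1 then Gout i.succ s
    else if (i : ℕ) = j + 1 then -Gin i.castSucc s
    else 0

/-- Transfer matrix from the disturbances `d 0` (inflow at the top), `d 1, …, d (n + 1)` (off-takes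
of the `n + 1` pools) and `d (n + 2)` (outflow at the bottom) to the outputs. -/
def disturbancePlant {n : ℕ} (Gin Gout : Fin (n + 1) → ℂ → ℂ) (s : ℂ) :
    Matrix (Fin n) (Fin (n + 3)) ℂ :=
  Matrix.of fun i l =>
    if (i : ℕ) = 0 ∧ (l : ℕ) = 0 then -Gin i.castSucc s
    else if (l : ℕ) = i + 1 then -Gout i.castSucc s
    else if (l : ℕ) = i + 2 then Gout i.succ s
    else if (i : ℕ) + 1 = n ∧ (l : ℕ) = n + 2 then Gout i.succ s
    else 0

/-- PI compensator with low-pass filter. -/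
def IsPI (C : ℂ → ℂ) : Prop :=
  ∃ Kp TI TF : ℝ, 0 < Kp ∧ 0 < TI ∧ 0 < TF ∧
    ∀ s : ℂ, C s = -(Kp : ℂ) * (1 + 1 / ((TI : ℂ) * s)) * (1 / (1 + (TF : ℂ) * s))

/-- The transfer matrix with the columns of the loops closed before step `m` set to zero. -/
def maskedPlant {n : ℕ} (Gin Gout : Fin (n + 1) → ℂ → ℂ) (ν : Equiv.Perm (Fin n)) (m : Fin n)
    (s : ℂ) : Matrix (Fin n) (Fin n) ℂ :=
  Matrix.of fun k l => if ν.symm l < m then 0 else plant Gin Gout s k l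

/-- Transfer matrix from gate flows to outputs at step `m`, with the loops
`u (ν p) = C (ν p) * y (ν p)`, `p < m`, closed. -/
def partialPlant {n : ℕ} (Gin Gout : Fin (n + 1) → ℂ → ℂ) (ν : Equiv.Perm (Fin n))
    (C : Fin n → ℂ → ℂ) (m : Fin n) (s : ℂ) : Matrix (Fin n) (Fin n) ℂ :=
  let ι : {p : Fin n // p < m} → Fin n := fun p => ν p
  let G := plant Gin Gout s
  let Gt := maskedPlant Gin Gout ν m s
  let D : Matrix {p : Fin n // p < m} {p : Fin n // p < m} ℂ := Matrix.diagonal fun p => C (ι p) s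
  Gt + G.submatrix id ι * D * (1 - G.submatrix ι ι * D)⁻¹ * Gt.submatrix ι id

/-- The SISO plant from `u (ν m)` to `y (ν m)` seen at step `m`. -/
def stepPlant {n : ℕ} (Gin Gout : Fin (n + 1) → ℂ → ℂ) (ν : Equiv.Perm (Fin n))
    (C : Fin n → ℂ → ℂ) (m : Fin n) (s : ℂ) : ℂ :=
  partialPlant Gin Gout ν C m s (ν m) (ν m)

/-- Closed-loop stability of the SISO positive feedback loop `y = P (u + v)`, `u = C (y + w)`: the
loop is well posed, and the sensitivity `(1 - P C)⁻¹`, `P (1 - P C)⁻¹`, `C (1 - P C)⁻¹` (hence also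
`P C (1 - P C)⁻¹`) are stable. -/
def ClosedLoopStable (P C : ℂ → ℂ) : Prop :=
  (∀ s : ℂ, 0 ≤ s.re → s ≠ 0 → 1 - P s * C s ≠ 0) ∧
  Stable (fun s => (1 - P s * C s)⁻¹) ∧
  Stable (fun s => P s * (1 - P s * C s)⁻¹) ∧
  Stable (fun s => C s * (1 - P s * C s)⁻¹)

/-- The loop has exactly one crossover frequency `ωc > 0`, and there the phase of `-P C` is
`-180 + φ` degrees. -/
def HasPhaseMargin (P C : ℂ → ℂ) (φ : ℝ) : Prop :=
  ∃ ωc : ℝ, 0 < ωc ∧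
    (∀ ω : ℝ, 0 < ω →
      (‖P (Complex.I * (ω : ℂ)) * C (Complex.I * (ω : ℂ))‖ = 1 ↔ ω = ωc)) ∧
    -(P (Complex.I * (ωc : ℂ)) * C (Complex.I * (ωc : ℂ))) =
      Complex.exp ((((-180 + φ) * (Real.pi / 180) : ℝ) : ℂ) * Complex.I)

/-- The loop matrix `I - G C` with `C` diagonal. -/
def loopMatrix {n : ℕ} (Gin Gout : Fin (n + 1) → ℂ → ℂ) (C : Fin n → ℂ → ℂ) (s : ℂ) :
    Matrix (Fin n) (Fin n) ℂ :=
  1 - plant Gin Gout s * Matrix.diagonal fun i => C i s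

/-- The MIMO closed loop `(I - G C)⁻¹ Gᵈ` from disturbances to outputs. -/
def closedLoop {n : ℕ} (Gin Gout : Fin (n + 1) → ℂ → ℂ) (C : Fin n → ℂ → ℂ) (s : ℂ) :
    Matrix (Fin n) (Fin (n + 3)) ℂ :=
  (loopMatrix Gin Gout C s)⁻¹ * disturbancePlant Gin Gout s

/-- Laplace transform of the output under the constant disturbances `d`, switched on at `t = 0`. -/
def outputHat {n : ℕ} (Gin Gout : Fin (n + 1) → ℂ → ℂ) (C : Fin n → ℂ → ℂ) (d : Fin (n + 3) → ℝ)
    (s : ℂ) : Fin n → ℂ :=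
  (closedLoop Gin Gout C s).mulVec fun l => (d l : ℂ) / s

/-- `y`, on `t ≥ 0`, is the time-domain output with Laplace transform `yhat` (on some right
half-plane). A Laplace transform fixes a function only up to null sets; right-continuity selects
the step response itself. -/
def IsTimeOutput {n : ℕ} (yhat : ℂ → Fin n → ℂ) (y : ℝ → Fin n → ℝ) : Prop :=
  (∀ t : ℝ, 0 ≤ t → ContinuousWithinAt y (Ici t) t) ∧
  ∃ σ : ℝ, 0 ≤ σ ∧ ∀ s : ℂ, σ < s.re → ∀ k : Fin n,
    IntegrableOn (fun t : ℝ => Complex.exp (-s * (t : ℂ)) * (y t k : ℂ)) (Ioi 0) ∧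
    ∫ t in Ioi (0 : ℝ), Complex.exp (-s * (t : ℂ)) * (y t k : ℂ) = yhat s k

end Channel

end

noncomputable section

namespace Channel

/-! Stable transfer functions are Laplace transforms of exponentially weighted measures. They form
an algebra under convolution in which `1 + F` is invertible as soon as `F` has weighted mass below
one (`StableWith.inv_one_add`). Closed-loop stability is proved inside this algebra, with no Nyquist
argument.

A single design step (`exists_PI_phaseMargin`) needs only that the plant is `g / s` plus a stable
term, with `g > 0`. In the time scale `s ↦ k s`, a PI loop with crossover `k → 0` is a small
perturbation of the double-integrator loop with characteristic polynomial `s² + s sin θ + cos θ`,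
where `θ` is the phase margin in radians.

The gain `g` is positive at every step for the following reason. The residue matrix of the plant at
the origin is `Bᵀ diag(1/c) B`, with `B` the incidence matrix of the path of pools, so it is
positive definite. Closing a loop replaces it by a Schur complement, which stays positive on the
loops still open (`PositiveOff.schur`); hence so are its open diagonal entries.

Plant and compensator each contribute an integrator, so the sensitivity has a double zero at the
origin (`ClosedLoopStable.sensitivity_bounds`). This cancels the integrator in the row being closed
and leaves one zero over; later closings keep that zero (`IntegratorMatrix.close`). With all rows
closed, the disturbance responses are stable and vanish at the origin. The step response is the
distribution function of the impulse response, so it tends to the total mass, which is the transfer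
function at the origin, namely zero. -/

open scoped ENNReal NNReal

/-! ### Exponentially weighted measures and their Laplace transforms -/

/-- Total mass of a measure with respect to the exponential weight `exp (ε t)`. -/
def weightedMass (ε : ℝ) (μ : Measure ℝ) : ℝ≥0∞ :=
  ∫⁻ t, ENNReal.ofReal (Real.exp (ε * t)) ∂μ

/-- Laplace transform of a measure. -/
def laplace (μ : Measure ℝ) (s : ℂ) : ℂ := ∫ t : ℝ, Complex.exp (-s * (t : ℂ)) ∂μ

theorem measurable_weight (ε : ℝ) : Measurable fun t : ℝ => ENNReal.ofReal (Real.exp (ε * t)) := by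
  fun_prop

section OneSided

variable {ε : ℝ} {μ ν : Measure ℝ}

theorem ae_nonneg (h0 : μ (Iio 0) = 0) : ∀ᵐ t ∂μ, 0 ≤ t := by
  rw [ae_iff]
  convert h0 using 2
  ext t
  simp

theorem mass_le_weightedMass (hε : 0 ≤ ε) (h0 : μ (Iio 0) = 0) : μ univ ≤ weightedMass ε μ := by
  rw [weightedMass, ← lintegral_one]
  refine lintegral_mono_ae ?_
  filter_upwards [ae_nonneg h0] with t ht
  rw [← ENNReal.ofReal_one]
  exact ENNReal.ofReal_le_ofReal (Real.one_le_exp (by positivity))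

theorem isFiniteMeasure_of_weightedMass (hε : 0 ≤ ε) (h0 : μ (Iio 0) = 0)
    (hw : weightedMass ε μ ≠ ∞) : IsFiniteMeasure μ :=
  ⟨(mass_le_weightedMass hε h0).trans_lt hw.lt_top⟩

theorem integrable_weight_iff :
    Integrable (fun t : ℝ => Real.exp (ε * t)) μ ↔ weightedMass ε μ ≠ ∞ := by
  constructor
  · intro h
    have := h.2
    rw [hasFiniteIntegral_iff_ofReal (Eventually.of_forall fun t => (Real.exp_pos _).le)] at this
    exact this.ne
  · intro h
    refine ⟨by fun_prop, ?_⟩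
    rw [hasFiniteIntegral_iff_ofReal (Eventually.of_forall fun t => (Real.exp_pos _).le)]
    exact h.lt_top

theorem norm_exp_le (hε : 0 ≤ ε) {s : ℂ} (hs : 0 ≤ s.re) {t : ℝ} (ht : 0 ≤ t) :
    ‖Complex.exp (-s * (t : ℂ))‖ ≤ Real.exp (ε * t) := by
  rw [Complex.norm_exp]
  apply Real.exp_le_exp.2
  have h1 : (-s * (t : ℂ)).re = -(s.re * t) := by simp
  rw [h1]
  have := mul_nonneg hs ht
  have := mul_nonneg hε ht
  linarith

theorem integrable_exp (hε : 0 ≤ ε) (h0 : μ (Iio 0) = 0) (hw : weightedMass ε μ ≠ ∞)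
    {s : ℂ} (hs : 0 ≤ s.re) : Integrable (fun t : ℝ => Complex.exp (-s * (t : ℂ))) μ := by
  refine (integrable_weight_iff.2 hw).mono' (by fun_prop) ?_
  filter_upwards [ae_nonneg h0] with t ht using norm_exp_le hε hs ht

theorem norm_laplace_le (hε : 0 ≤ ε) (h0 : μ (Iio 0) = 0) (hw : weightedMass ε μ ≠ ∞)
    {s : ℂ} (hs : 0 ≤ s.re) : ‖laplace μ s‖ ≤ (weightedMass ε μ).toReal := by
  have h1 : ∫ t, Real.exp (ε * t) ∂μ = (weightedMass ε μ).toReal :=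
    integral_eq_lintegral_of_nonneg_ae (Eventually.of_forall fun t => (Real.exp_pos _).le)
      (by fun_prop)
  rw [← h1]
  refine norm_integral_le_of_norm_le (integrable_weight_iff.2 hw) ?_
  filter_upwards [ae_nonneg h0] with t ht using norm_exp_le hε hs ht

theorem weightedMass_add : weightedMass ε (μ + ν) = weightedMass ε μ + weightedMass ε ν :=
  lintegral_add_measure _ _ _

theorem weightedMass_smul (c : ℝ≥0∞) : weightedMass ε (c • μ) = c * weightedMass ε μ :=
  lintegral_smul_measure _ _

theorem weightedMass_conv [SFinite ν] :
    weightedMass ε (μ.conv ν) = weightedMass ε μ * weightedMass ε ν := by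
  rw [weightedMass, Measure.lintegral_conv (measurable_weight ε)]
  simp_rw [mul_add, Real.exp_add, ENNReal.ofReal_mul (Real.exp_pos _).le]
  simp_rw [lintegral_const_mul _ (measurable_weight ε)]
  rw [lintegral_mul_const _ (measurable_weight ε)]
  rfl

theorem laplace_conv [SFinite μ] [SFinite ν] (s : ℂ) :
    laplace (μ.conv ν) s = laplace μ s * laplace ν s := by
  rw [laplace, Measure.conv, integral_map (by fun_prop) (by fun_prop), laplace, laplace,
    ← integral_prod_mul]
  congr 1
  ext x
  rw [← Complex.exp_add]
  congr 1
  push_cast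
  ring

theorem conv_Iio [SFinite μ] [SFinite ν] (h0 : μ (Iio 0) = 0) (h1 : ν (Iio 0) = 0) :
    (μ.conv ν) (Iio 0) = 0 := by
  have h : ∀ᵐ x ∂(μ.prod ν), 0 ≤ x.1 + x.2 := by
    have a := (Measure.quasiMeasurePreserving_fst (μ := μ) (ν := ν)).ae (ae_nonneg h0)
    have b := (Measure.quasiMeasurePreserving_snd (μ := μ) (ν := ν)).ae (ae_nonneg h1)
    filter_upwards [a, b] with x hx hy using add_nonneg hx hy
  rw [Measure.conv, Measure.map_apply (by fun_prop) measurableSet_Iio]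
  rw [ae_iff] at h
  convert h using 2
  ext x
  simp

theorem laplace_add {s : ℂ} (hμ : Integrable (fun t : ℝ => Complex.exp (-s * (t : ℂ))) μ)
    (hν : Integrable (fun t : ℝ => Complex.exp (-s * (t : ℂ))) ν) :
    laplace (μ + ν) s = laplace μ s + laplace ν s :=
  integral_add_measure hμ hν

theorem weightedMass_map {k : ℝ} :
    weightedMass ε (μ.map fun t => k * t) = weightedMass (ε * k) μ := by
  rw [weightedMass, lintegral_map (measurable_weight ε) (by fun_prop)]
  simp_rw [← mul_assoc]
  rfl

theorem laplace_map {k : ℝ} (s : ℂ) :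
    laplace (μ.map fun t => k * t) s = laplace μ (k * s) := by
  rw [laplace, integral_map (by fun_prop) (by fun_prop), laplace]
  congr 1
  ext t
  congr 1
  push_cast
  ring

theorem map_Iio {k : ℝ} (hk : 0 < k) (h0 : μ (Iio 0) = 0) :
    (μ.map fun t => k * t) (Iio 0) = 0 := by
  rw [Measure.map_apply (by fun_prop) measurableSet_Iio]
  convert h0 using 2
  ext t
  simp [hk]

theorem weightedMass_mono {δ : ℝ} (h : δ ≤ ε) (h0 : μ (Iio 0) = 0) :
    weightedMass δ μ ≤ weightedMass ε μ := by
  refine lintegral_mono_ae ?_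
  filter_upwards [ae_nonneg h0] with t ht
  exact ENNReal.ofReal_le_ofReal (Real.exp_le_exp.2 (mul_le_mul_of_nonneg_right h ht))

end OneSided

/-! ### The convolution algebra of stable transfer functions -/

/-- Quantitative stability: the impulse response is `μ₁ - μ₂` with total mass at most `M` for the
weight `exp (ε t)`. -/
def StableWith (ε : ℝ) (M : ℝ≥0) (F : ℂ → ℂ) : Prop :=
  ∃ μ₁ μ₂ : Measure ℝ, μ₁ (Iio 0) = 0 ∧ μ₂ (Iio 0) = 0 ∧
    weightedMass ε μ₁ + weightedMass ε μ₂ ≤ M ∧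
    ∀ s : ℂ, 0 ≤ s.re → s ≠ 0 → F s = laplace μ₁ s - laplace μ₂ s

theorem weightedMass_ne_top {ε : ℝ} {M : ℝ≥0} {μ₁ μ₂ : Measure ℝ}
    (h : weightedMass ε μ₁ + weightedMass ε μ₂ ≤ M) :
    weightedMass ε μ₁ ≠ ∞ ∧ weightedMass ε μ₂ ≠ ∞ :=
  ENNReal.add_ne_top.1 (h.trans_lt ENNReal.coe_lt_top).ne

theorem StableWith.stable {ε : ℝ} {M : ℝ≥0} {F : ℂ → ℂ} (hε : 0 < ε) (h : StableWith ε M F) :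
    Stable F := by
  obtain ⟨μ₁, μ₂, h1, h2, hM, hF⟩ := h
  obtain ⟨f1, f2⟩ := weightedMass_ne_top hM
  exact ⟨μ₁, μ₂, ε, hε, h1, h2, integrable_weight_iff.2 f1, integrable_weight_iff.2 f2, hF⟩

theorem Stable.exists_stableWith {F : ℂ → ℂ} (h : Stable F) : ∃ ε > 0, ∃ M, StableWith ε M F := by
  obtain ⟨μ₁, μ₂, ε, hε, h1, h2, i1, i2, hF⟩ := h
  refine ⟨ε, hε, (weightedMass ε μ₁ + weightedMass ε μ₂).toNNReal, μ₁, μ₂, h1, h2, ?_, hF⟩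
  rw [ENNReal.coe_toNNReal]
  exact ENNReal.add_ne_top.2 ⟨integrable_weight_iff.1 i1, integrable_weight_iff.1 i2⟩

namespace StableWith

variable {ε δ : ℝ} {M N : ℝ≥0} {F G : ℂ → ℂ}

theorem congr (h : StableWith ε M F) (hFG : ∀ s : ℂ, 0 ≤ s.re → s ≠ 0 → G s = F s) :
    StableWith ε M G := by
  obtain ⟨μ₁, μ₂, h1, h2, hM, hF⟩ := h
  exact ⟨μ₁, μ₂, h1, h2, hM, fun s hs h0 => (hFG s hs h0).trans (hF s hs h0)⟩

theorem mono (h : StableWith ε M F) (hδ : δ ≤ ε) (hN : M ≤ N) : StableWith δ N F := by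
  obtain ⟨μ₁, μ₂, h1, h2, hM, hF⟩ := h
  refine ⟨μ₁, μ₂, h1, h2, ?_, hF⟩
  calc _ ≤ weightedMass ε μ₁ + weightedMass ε μ₂ :=
        add_le_add (weightedMass_mono hδ h1) (weightedMass_mono hδ h2)
    _ ≤ M := hM
    _ ≤ N := by exact_mod_cast hN

theorem norm_le (hε : 0 ≤ ε) (h : StableWith ε M F) {s : ℂ} (hs : 0 ≤ s.re) (h0 : s ≠ 0) :
    ‖F s‖ ≤ M := by
  obtain ⟨μ₁, μ₂, h1, h2, hM, hF⟩ := h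
  obtain ⟨f1, f2⟩ := weightedMass_ne_top hM
  rw [hF s hs h0]
  refine (norm_sub_le _ _).trans ((add_le_add (norm_laplace_le hε h1 f1 hs)
    (norm_laplace_le hε h2 f2 hs)).trans ?_)
  rw [← ENNReal.toReal_add f1 f2]
  exact ENNReal.toReal_mono ENNReal.coe_ne_top hM

theorem add (hε : 0 ≤ ε) (hF : StableWith ε M F) (hG : StableWith ε N G) :
    StableWith ε (M + N) (fun s => F s + G s) := by
  obtain ⟨μ₁, μ₂, h1, h2, hM, hF⟩ := hF
  obtain ⟨ν₁, ν₂, k1, k2, hN, hG⟩ := hG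
  obtain ⟨f1, f2⟩ := weightedMass_ne_top hM
  obtain ⟨g1, g2⟩ := weightedMass_ne_top hN
  refine ⟨μ₁ + ν₁, μ₂ + ν₂, by simp [h1, k1], by simp [h2, k2], ?_, fun s hs h0 => ?_⟩
  · rw [weightedMass_add, weightedMass_add, add_add_add_comm]
    push_cast
    exact add_le_add hM hN
  · rw [laplace_add (integrable_exp hε h1 f1 hs) (integrable_exp hε k1 g1 hs),
      laplace_add (integrable_exp hε h2 f2 hs) (integrable_exp hε k2 g2 hs)]
    simp only [hF s hs h0, hG s hs h0]
    ring

/-- The weighted mass is multiplicative on convolutions of positive measures, so expanding the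
product of differences gives exactly the bound `M * N`. Without a constant in front, powers are
bounded by `M ^ n`. -/
theorem mul (hε : 0 ≤ ε) (hF : StableWith ε M F) (hG : StableWith ε N G) :
    StableWith ε (M * N) (fun s => F s * G s) := by
  obtain ⟨μ₁, μ₂, h1, h2, hM, hF⟩ := hF
  obtain ⟨ν₁, ν₂, k1, k2, hN, hG⟩ := hG
  obtain ⟨f1, f2⟩ := weightedMass_ne_top hM
  obtain ⟨g1, g2⟩ := weightedMass_ne_top hN
  have := isFiniteMeasure_of_weightedMass hε h1 f1
  have := isFiniteMeasure_of_weightedMass hε h2 f2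
  have := isFiniteMeasure_of_weightedMass hε k1 g1
  have := isFiniteMeasure_of_weightedMass hε k2 g2
  refine ⟨μ₁.conv ν₁ + μ₂.conv ν₂, μ₁.conv ν₂ + μ₂.conv ν₁, by simp [conv_Iio, *],
    by simp [conv_Iio, *], ?_, fun s hs h0 => ?_⟩
  · simp only [weightedMass_add, weightedMass_conv]
    push_cast
    refine le_trans (le_of_eq ?_) (mul_le_mul' hM hN)
    ring
  · have int : ∀ {μ ν : Measure ℝ} [IsFiniteMeasure μ] [IsFiniteMeasure ν], μ (Iio 0) = 0 →
        ν (Iio 0) = 0 → weightedMass ε μ ≠ ∞ → weightedMass ε ν ≠ ∞ →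
        Integrable (fun t : ℝ => Complex.exp (-s * (t : ℂ))) (μ.conv ν) :=
      fun a b c d => integrable_exp hε (conv_Iio a b)
        (by rw [weightedMass_conv]; exact ENNReal.mul_ne_top c d) hs
    rw [laplace_add (int h1 k1 f1 g1) (int h2 k2 f2 g2), laplace_add (int h1 k2 f1 g2)
      (int h2 k1 f2 g1)]
    simp only [laplace_conv, hF s hs h0, hG s hs h0]
    ring

theorem const (r : ℝ) : StableWith ε ‖r‖₊ (fun _ => (r : ℂ)) := by
  refine ⟨ENNReal.ofReal r • Measure.dirac 0, ENNReal.ofReal (-r) • Measure.dirac 0,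
    by simp, by simp, ?_, fun s _ _ => ?_⟩
  · simp only [weightedMass_smul]
    have : weightedMass ε (Measure.dirac 0) = 1 := by simp [weightedMass]
    rw [this, mul_one, mul_one]
    change _ ≤ ‖r‖ₑ
    rw [← ofReal_norm]
    rcases le_total 0 r with h | h
    · rw [ENNReal.ofReal_of_nonpos (neg_nonpos.2 h), add_zero, Real.norm_of_nonneg h]
    · rw [ENNReal.ofReal_of_nonpos h, zero_add, Real.norm_of_nonpos h]
  · simp only [laplace, integral_smul_measure, integral_dirac]
    rcases le_total 0 r with h | h
    · simp [h, ENNReal.ofReal_of_nonpos (neg_nonpos.2 h)]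
    · simp [h, ENNReal.ofReal_of_nonpos h]

theorem const_mul (hε : 0 ≤ ε) (r : ℝ) (hF : StableWith ε M F) :
    StableWith ε (‖r‖₊ * M) (fun s => r * F s) :=
  (const r).mul hε hF

theorem pow (hε : 0 ≤ ε) (hF : StableWith ε M F) (n : ℕ) :
    StableWith ε (M ^ n) (fun s => F s ^ n) := by
  induction n with
  | zero => simpa using const (ε := ε) 1
  | succ n ih => simpa only [pow_succ] using ih.mul hε hF

/-- Stretching time by `k` keeps the mass but divides the decay rate by `k`. For small `k` the same
mass bound is therefore available uniformly. -/
theorem comp_mul {k : ℝ} (hk : 0 < k) (hF : StableWith (ε * k) M F) :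
    StableWith ε M (fun s => F (k * s)) := by
  obtain ⟨μ₁, μ₂, h1, h2, hM, hF⟩ := hF
  refine ⟨μ₁.map fun t => k * t, μ₂.map fun t => k * t, map_Iio hk h1, map_Iio hk h2, ?_,
    fun s hs h0 => ?_⟩
  · simpa only [weightedMass_map] using hM
  · rw [laplace_map, laplace_map]
    exact hF _ (by simpa using mul_nonneg hk.le hs) (mul_ne_zero (by simpa using hk.ne') h0)

theorem one_add_ne_zero (hε : 0 ≤ ε) (hF : StableWith ε M F) (hM : M < 1)
    {s : ℂ} (hs : 0 ≤ s.re) (h0 : s ≠ 0) : 1 + F s ≠ 0 := by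
  intro h
  have h1 := hF.norm_le hε hs h0
  rw [eq_neg_of_add_eq_zero_right h, norm_neg, norm_one] at h1
  exact absurd hM (not_lt.2 (by exact_mod_cast h1))

/-- Neumann series: the impulse response of the inverse is the sum of the convolution powers of
`-F`, whose masses form a geometric series. -/
theorem inv_one_add (hε : 0 ≤ ε) (hF : StableWith ε M F) (hM : M < 1) :
    StableWith ε (1 - M)⁻¹ (fun s => (1 + F s)⁻¹) := by
  have hneg : StableWith ε M (fun s => -F s) := by
    simpa using hF.const_mul hε (-1)
  choose μ₁ μ₂ h1 h2 hb hs using fun n : ℕ => hneg.pow hε n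
  have hsum : weightedMass ε (Measure.sum μ₁) + weightedMass ε (Measure.sum μ₂) ≤
      ((1 - M)⁻¹ : ℝ≥0) := by
    rw [weightedMass, weightedMass, lintegral_sum_measure, lintegral_sum_measure,
      ← ENNReal.tsum_add]
    refine (ENNReal.tsum_le_tsum hb).trans (le_of_eq ?_)
    have h1M : (1 - M : ℝ≥0) ≠ 0 := (tsub_pos_of_lt hM).ne'
    simp only [ENNReal.coe_pow]
    rw [ENNReal.tsum_geometric, ENNReal.coe_inv h1M]
    push_cast
    rfl
  obtain ⟨f1, f2⟩ := weightedMass_ne_top hsum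
  have n1 : (Measure.sum μ₁) (Iio 0) = 0 := by simp [Measure.sum_apply _ measurableSet_Iio, h1]
  have n2 : (Measure.sum μ₂) (Iio 0) = 0 := by simp [Measure.sum_apply _ measurableSet_Iio, h2]
  refine ⟨Measure.sum μ₁, Measure.sum μ₂, n1, n2, hsum, fun s hs0 h0 => ?_⟩
  have e1 := hasSum_integral_measure (integrable_exp hε n1 f1 hs0)
  have e2 := hasSum_integral_measure (integrable_exp hε n2 f2 hs0)
  have e := e1.sub e2
  have hlt : ‖-F s‖ < 1 := (hneg.norm_le hε hs0 h0).trans_lt (by exact_mod_cast hM)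
  have g := hasSum_geometric_of_norm_lt_one hlt
  rw [sub_neg_eq_add] at g
  refine g.unique ?_
  refine e.congr_fun ?_
  intro n
  exact hs n s hs0 h0

end StableWith

namespace Stable

variable {F G : ℂ → ℂ}

theorem congr (h : Stable F) (hFG : ∀ s : ℂ, 0 ≤ s.re → s ≠ 0 → G s = F s) : Stable G := by
  obtain ⟨ε, hε, M, h⟩ := h.exists_stableWith
  exact (h.congr hFG).stable hε

theorem exists_common (hF : Stable F) (hG : Stable G) :
    ∃ ε > 0, (∃ M, StableWith ε M F) ∧ ∃ N, StableWith ε N G := by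
  obtain ⟨ε, hε, M, hF⟩ := hF.exists_stableWith
  obtain ⟨δ, hδ, N, hG⟩ := hG.exists_stableWith
  exact ⟨min ε δ, lt_min hε hδ, ⟨M, hF.mono (min_le_left _ _) le_rfl⟩,
    ⟨N, hG.mono (min_le_right _ _) le_rfl⟩⟩

theorem add (hF : Stable F) (hG : Stable G) : Stable (fun s => F s + G s) := by
  obtain ⟨ε, hε, ⟨M, hF⟩, ⟨N, hG⟩⟩ := exists_common hF hG
  exact (hF.add hε.le hG).stable hε

theorem mul (hF : Stable F) (hG : Stable G) : Stable (fun s => F s * G s) := by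
  obtain ⟨ε, hε, ⟨M, hF⟩, ⟨N, hG⟩⟩ := exists_common hF hG
  exact (hF.mul hε.le hG).stable hε

theorem const (r : ℝ) : Stable (fun _ => (r : ℂ)) :=
  (StableWith.const (ε := 1) r).stable one_pos

theorem const_mul (r : ℝ) (hF : Stable F) : Stable (fun s => r * F s) := (const r).mul hF

theorem neg (hF : Stable F) : Stable (fun s => -F s) := by simpa using hF.const_mul (-1)

theorem sub (hF : Stable F) (hG : Stable G) : Stable (fun s => F s - G s) := by
  simpa only [sub_eq_add_neg] using hF.add hG.neg

theorem sum {ι : Type*} (S : Finset ι) {F : ι → ℂ → ℂ} (h : ∀ i ∈ S, Stable (F i)) :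
    Stable (fun s => ∑ i ∈ S, F i s) := by
  classical
  induction S using Finset.induction_on with
  | empty => simpa using const 0
  | insert i S hi ih =>
    simp only [Finset.sum_insert hi]
    exact (h i (by simp)).add (ih fun j hj => h j (by simp [hj]))

theorem comp_mul {k : ℝ} (hk : 0 < k) (hF : Stable F) : Stable (fun s => F (k * s)) := by
  obtain ⟨ε, hε, M, h⟩ := hF.exists_stableWith
  refine StableWith.stable (ε := ε / k) (M := M) (by positivity) (StableWith.comp_mul hk ?_)
  rwa [div_mul_cancel₀ _ hk.ne']

theorem of_comp_mul {k : ℝ} (hk : 0 < k) (hF : Stable (fun s => F (k * s))) : Stable F := by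
  have := hF.comp_mul (inv_pos.2 hk)
  refine this.congr fun s _ _ => ?_
  have hk' : (k : ℂ) ≠ 0 := by exact_mod_cast hk.ne'
  push_cast
  rw [← mul_assoc, mul_inv_cancel₀ hk', one_mul]

theorem exists_norm_le (hF : Stable F) :
    ∃ M : ℝ, 0 ≤ M ∧ ∀ s : ℂ, 0 ≤ s.re → s ≠ 0 → ‖F s‖ ≤ M := by
  obtain ⟨ε, hε, M, h⟩ := hF.exists_stableWith
  exact ⟨M, M.2, fun s hs h0 => h.norm_le hε.le hs h0⟩

end Stable

/-! ### Lipschitz frequency responses and explicit stable transfer functions -/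

theorem norm_laplace_sub_le {ε : ℝ} {μ : Measure ℝ} (hε : 0 < ε) (h0 : μ (Iio 0) = 0)
    (hw : weightedMass ε μ ≠ ∞) (u v : ℝ) :
    ‖laplace μ (Complex.I * u) - laplace μ (Complex.I * v)‖ ≤
      (weightedMass ε μ).toReal / ε * |u - v| := by
  have h1 : ∫ t, Real.exp (ε * t) ∂μ = (weightedMass ε μ).toReal :=
    integral_eq_lintegral_of_nonneg_ae (Eventually.of_forall fun t => (Real.exp_pos _).le)
      (by fun_prop)
  have hfint := integrable_weight_iff.2 hw
  have hre : ∀ w : ℝ, 0 ≤ (Complex.I * (w : ℂ)).re := fun w => by simp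
  rw [← h1, laplace, laplace, ← integral_sub (integrable_exp hε.le h0 hw (hre u))
    (integrable_exp hε.le h0 hw (hre v)), div_mul_eq_mul_div, mul_div_assoc, ← integral_mul_const]
  refine norm_integral_le_of_norm_le (hfint.mul_const _) ?_
  filter_upwards [ae_nonneg h0] with t ht
  have e1 : Complex.exp (-(Complex.I * u) * t) - Complex.exp (-(Complex.I * v) * t) =
      Complex.exp (-(Complex.I * v) * t) *
        (Complex.exp (Complex.I * ((-((u - v) * t) : ℝ) : ℂ)) - 1) := by
    rw [mul_sub, mul_one, ← Complex.exp_add]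
    congr 2
    push_cast
    ring
  have e2 : ‖Complex.exp (-(Complex.I * v) * t)‖ = 1 := by
    rw [Complex.norm_exp]
    simp
  rw [e1, norm_mul, e2, one_mul]
  refine (Real.norm_exp_I_mul_ofReal_sub_one_le).trans ?_
  rw [Real.norm_eq_abs, abs_neg, abs_mul, abs_of_nonneg ht, mul_comm, mul_div_assoc', le_div_iff₀ hε,
    mul_right_comm]
  -- What remains is `ε t ≤ exp (ε t)`: the exponential weight controls the first moment, which is
  -- the Lipschitz constant.
  refine mul_le_mul_of_nonneg_right ?_ (abs_nonneg _)
  have := Real.add_one_le_exp (ε * t)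
  linarith

theorem Stable.exists_lipschitz {F : ℂ → ℂ} (hF : Stable F) :
    ∃ M : ℝ, 0 ≤ M ∧ ∀ u v : ℝ, 0 < u → 0 < v →
      ‖F (Complex.I * u) - F (Complex.I * v)‖ ≤ M * |u - v| := by
  obtain ⟨ε, hε, M, μ₁, μ₂, h1, h2, hM, hF⟩ := hF.exists_stableWith
  obtain ⟨f1, f2⟩ := weightedMass_ne_top hM
  refine ⟨(weightedMass ε μ₁).toReal / ε + (weightedMass ε μ₂).toReal / ε, by positivity,
    fun u v hu hv => ?_⟩
  have hne : ∀ w : ℝ, 0 < w → Complex.I * (w : ℂ) ≠ 0 := fun w hw => by simp [hw.ne']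
  rw [hF _ (by simp) (hne u hu), hF _ (by simp) (hne v hv), sub_sub_sub_comm, add_mul]
  exact (norm_sub_le _ _).trans (add_le_add (norm_laplace_sub_le hε h1 f1 u v)
    (norm_laplace_sub_le hε h2 f2 u v))

/-- An exponentially decaying impulse response is stable. -/
theorem stable_of_density {f : ℝ → ℝ} {A α : ℝ} (hα : 0 < α) (hf : Continuous f)
    (hb : ∀ t, 0 < t → |f t| ≤ A * Real.exp (-α * t)) :
    Stable (fun s => ∫ t in Ioi (0 : ℝ), Complex.exp (-s * (t : ℂ)) * (f t : ℂ)) := by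
  -- Half of the decay rate is spent on the weight. `ENNReal.ofReal` truncates at zero, so applying
  -- this to `f` and `-f` yields the positive and negative parts.
  have key : ∀ g : ℝ → ℝ, Continuous g → (∀ t, 0 < t → g t ≤ A * Real.exp (-α * t)) →
      Integrable (fun t => Real.exp (α / 2 * t))
        ((volume.restrict (Ioi (0 : ℝ))).withDensity fun t => ENNReal.ofReal (g t)) := by
    intro g hg hgb
    rw [integrable_withDensity_iff_integrable_smul' (by fun_prop) (by simp)]
    have h1 : IntegrableOn (fun t : ℝ => |A| * Real.exp (-(α / 2) * t)) (Ioi 0) :=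
      (integrableOn_exp_mul_Ioi (by linarith) 0).const_mul _
    refine h1.mono' (Continuous.aestronglyMeasurable ?_) ?_
    · simp only [smul_eq_mul, ENNReal.toReal_ofReal']
      fun_prop
    · filter_upwards [ae_restrict_mem measurableSet_Ioi] with t ht
      rw [smul_eq_mul, ENNReal.toReal_ofReal', norm_mul, Real.norm_of_nonneg (le_max_right _ _),
        Real.norm_of_nonneg (Real.exp_pos _).le]
      have h2 : max (g t) 0 ≤ |A| * Real.exp (-α * t) := by
        refine max_le ((hgb t ht).trans ?_) (by positivity)
        exact mul_le_mul_of_nonneg_right (le_abs_self A) (Real.exp_pos _).le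
      calc max (g t) 0 * Real.exp (α / 2 * t)
          ≤ |A| * Real.exp (-α * t) * Real.exp (α / 2 * t) :=
            mul_le_mul_of_nonneg_right h2 (Real.exp_pos _).le
        _ = |A| * Real.exp (-(α / 2) * t) := by
            rw [mul_assoc, ← Real.exp_add]
            congr 2
            ring
  have zero : ∀ g : ℝ → ℝ≥0∞,
      ((volume.restrict (Ioi (0 : ℝ))).withDensity g) (Iio 0) = 0 := by
    intro g
    rw [withDensity_apply _ measurableSet_Iio, Measure.restrict_restrict measurableSet_Iio]
    have : Iio (0 : ℝ) ∩ Ioi 0 = ∅ := by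
      ext x
      simp only [mem_inter_iff, mem_Iio, mem_Ioi, mem_empty_iff_false, iff_false]
      intro h
      linarith [h.1, h.2]
    simp [this]
  have k1 := key f hf fun t ht => (le_abs_self _).trans (hb t ht)
  have k2 := key (fun t => -f t) hf.neg fun t ht => (neg_le_abs _).trans (hb t ht)
  refine ⟨_, _, α / 2, by linarith, zero _, zero _, k1, k2, fun s hs _ => ?_⟩
  have i1 := integrable_exp (by linarith) (zero _) (integrable_weight_iff.1 k1) hs
  have i2 := integrable_exp (by linarith) (zero _) (integrable_weight_iff.1 k2) hs
  rw [integrable_withDensity_iff_integrable_smul' (by fun_prop) (by simp)] at i1 i2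
  rw [integral_withDensity_eq_integral_toReal_smul (by fun_prop) (by simp),
    integral_withDensity_eq_integral_toReal_smul (by fun_prop) (by simp), ← integral_sub i1 i2]
  refine integral_congr_ae (Eventually.of_forall fun t => ?_)
  beta_reduce
  rw [← sub_smul, ENNReal.toReal_ofReal', ENNReal.toReal_ofReal', Complex.real_smul, mul_comm]
  congr 2
  rcases le_total 0 (f t) with h | h
  · rw [max_eq_left h, max_eq_right (by linarith), sub_zero]
  · rw [max_eq_right h, max_eq_left (by linarith)]
    ring

theorem integral_exp_mul_exp {s z : ℂ} (h : z.re < s.re) :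
    IntegrableOn (fun t : ℝ => Complex.exp (-s * (t : ℂ)) * Complex.exp (z * t)) (Ioi 0) ∧
    ∫ t in Ioi (0 : ℝ), Complex.exp (-s * (t : ℂ)) * Complex.exp (z * t) = (s - z)⁻¹ := by
  have e : (fun t : ℝ => Complex.exp (-s * (t : ℂ)) * Complex.exp (z * t)) =
      fun t : ℝ => Complex.exp ((z - s) * t) := by
    ext t
    rw [← Complex.exp_add]
    congr 1
    ring
  have hre : (z - s).re < 0 := by simpa using h
  rw [e]
  refine ⟨integrableOn_exp_mul_complex_Ioi hre 0, ?_⟩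
  rw [integral_exp_mul_complex_Ioi hre 0]
  simp only [Complex.ofReal_zero, mul_zero, Complex.exp_zero]
  rw [← neg_sub z s, inv_neg, ← one_div, neg_div]

theorem stable_inv_add {r : ℝ} (hr : 0 < r) : Stable (fun s => (s + r)⁻¹) := by
  refine (stable_of_density (f := fun t => Real.exp (-r * t)) (A := 1) hr (by fun_prop) ?_).congr
    fun s hs _ => ?_
  · intro t _
    rw [one_mul, abs_of_pos (Real.exp_pos _)]
  · have h := (integral_exp_mul_exp (s := s) (z := ((-r : ℝ) : ℂ)) (by simp; linarith)).2
    push_cast at h ⊢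
    rw [h, sub_neg_eq_add]

theorem stable_inv_one_add_mul {r : ℝ} (hr : 0 < r) : Stable (fun s => (1 + r * s)⁻¹) := by
  refine ((stable_inv_add (inv_pos.2 hr)).const_mul r⁻¹).congr fun s _ _ => ?_
  have hr' : (r : ℂ) ≠ 0 := by exact_mod_cast hr.ne'
  push_cast
  rw [← mul_inv, mul_add, mul_inv_cancel₀ hr', add_comm]

theorem add_ofReal_ne_zero {s : ℂ} (hs : 0 ≤ s.re) {r : ℝ} (hr : 0 < r) : s + r ≠ 0 := by
  intro h
  have := congrArg Complex.re h
  simp at this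
  linarith

theorem stable_div_add {r : ℝ} (hr : 0 < r) : Stable (fun s => s * (s + r)⁻¹) := by
  refine ((Stable.const 1).sub ((stable_inv_add hr).const_mul r)).congr fun s hs _ => ?_
  have := add_ofReal_ne_zero hs hr
  field_simp
  push_cast
  ring

theorem quadratic_ne_zero {a b : ℝ} (ha : 0 < a) (hb : 0 < b) {s : ℂ} (hs : 0 ≤ s.re) :
    s ^ 2 + a * s + b ≠ 0 := by
  intro h
  have h1 := congrArg Complex.re h
  have h2 := congrArg Complex.im h
  simp [pow_two] at h1 h2
  have h3 : s.im * (2 * s.re + a) = 0 := by linarith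
  rcases mul_eq_zero.1 h3 with h4 | h4
  · rw [h4] at h1
    nlinarith
  · linarith

/-- With real roots (a double root included) the quadratic is a product of two first-order lags.
With complex roots the impulse responses are damped sines and cosines; the cosine has numerator `s +
a / 2`, whence the final correction. -/
theorem stable_quadratic {a b : ℝ} (ha : 0 < a) (hb : 0 < b) :
    Stable (fun s => (s ^ 2 + a * s + b)⁻¹) ∧ Stable (fun s => s * (s ^ 2 + a * s + b)⁻¹) := by
  rcases le_or_gt (4 * b) (a ^ 2) with h | h
  · obtain ⟨d, hd0, hd⟩ : ∃ d : ℝ, 0 ≤ d ∧ d ^ 2 = a ^ 2 - 4 * b :=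
      ⟨√(a ^ 2 - 4 * b), Real.sqrt_nonneg _, Real.sq_sqrt (by linarith)⟩
    have hda : d < a := by nlinarith
    have hp : 0 < (a + d) / 2 := by linarith
    have hm : 0 < (a - d) / 2 := by linarith
    have hdc : (d : ℂ) ^ 2 = a ^ 2 - 4 * b := by exact_mod_cast hd
    have e : ∀ s : ℂ, s ^ 2 + a * s + b =
        (s + ((a + d) / 2 : ℝ)) * (s + ((a - d) / 2 : ℝ)) := by
      intro s
      push_cast
      linear_combination (1 / 4 : ℂ) * hdc
    refine ⟨((stable_inv_add hp).mul (stable_inv_add hm)).congr fun s _ _ => ?_,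
      ((stable_div_add hp).mul (stable_inv_add hm)).congr fun s _ _ => ?_⟩
    · rw [e, mul_inv]
    · rw [e, mul_inv, mul_assoc]
  · obtain ⟨β, hβ0, hβ⟩ : ∃ β : ℝ, 0 < β ∧ β ^ 2 = b - a ^ 2 / 4 :=
      ⟨√(b - a ^ 2 / 4), Real.sqrt_pos.2 (by linarith), Real.sq_sqrt (by linarith)⟩
    have hβ' : (β : ℂ) ≠ 0 := by exact_mod_cast hβ0.ne'
    have hβc : (β : ℂ) ^ 2 = b - a ^ 2 / 4 := by exact_mod_cast hβ
    have hα : 0 < a / 2 := by linarith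
    set z : ℂ := -(a / 2) + β * Complex.I with hz
    set w : ℂ := -(a / 2) - β * Complex.I with hw
    have hzre : z.re = -(a / 2) := by simp [hz]
    have hwre : w.re = -(a / 2) := by simp [hw]
    have hprod : ∀ s : ℂ, s ^ 2 + a * s + b = (s - z) * (s - w) := by
      intro s
      rw [hz, hw]
      linear_combination (β : ℂ) ^ 2 * Complex.I_sq - hβc
    have ez : ∀ t : ℝ, Complex.exp (z * t) = (Real.exp (-(a / 2) * t) : ℂ) *
        ((Real.cos (β * t) : ℂ) + (Real.sin (β * t) : ℂ) * Complex.I) := by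
      intro t
      have : z * t = ((-(a / 2) * t : ℝ) : ℂ) + ((β * t : ℝ) : ℂ) * Complex.I := by
        rw [hz]
        push_cast
        ring
      rw [this, Complex.exp_add, Complex.exp_mul_I, Complex.ofReal_exp, Complex.ofReal_cos,
        Complex.ofReal_sin]
    have ew : ∀ t : ℝ, Complex.exp (w * t) = (Real.exp (-(a / 2) * t) : ℂ) *
        ((Real.cos (β * t) : ℂ) - (Real.sin (β * t) : ℂ) * Complex.I) := by
      intro t
      have : w * t = ((-(a / 2) * t : ℝ) : ℂ) + ((-(β * t) : ℝ) : ℂ) * Complex.I := by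
        rw [hw]
        push_cast
        ring
      rw [this, Complex.exp_add, Complex.exp_mul_I, Complex.ofReal_exp, ← Complex.ofReal_cos,
        ← Complex.ofReal_sin, Real.cos_neg, Real.sin_neg]
      push_cast
      ring
    have S1 : Stable (fun s => (s ^ 2 + a * s + b)⁻¹) := by
      refine (stable_of_density (f := fun t => Real.exp (-(a / 2) * t) * (Real.sin (β * t) / β))
        (A := β⁻¹) hα (by fun_prop) ?_).congr fun s hs _ => ?_
      · intro t _
        rw [abs_mul, abs_of_pos (Real.exp_pos _), mul_comm, abs_div, abs_of_pos hβ0]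
        refine mul_le_mul_of_nonneg_right ?_ (Real.exp_pos _).le
        rw [div_eq_mul_inv]
        exact mul_le_of_le_one_left (inv_pos.2 hβ0).le (Real.abs_sin_le_one _)
      · obtain ⟨iz, vz⟩ := integral_exp_mul_exp (s := s) (z := z) (by rw [hzre]; linarith)
        obtain ⟨iw, vw⟩ := integral_exp_mul_exp (s := s) (z := w) (by rw [hwre]; linarith)
        have hsz : s - z ≠ 0 := fun h0 => by
          have := congrArg Complex.re h0
          rw [Complex.sub_re, hzre, Complex.zero_re] at this
          linarith
        have hsw : s - w ≠ 0 := fun h0 => by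
          have := congrArg Complex.re h0
          rw [Complex.sub_re, hwre, Complex.zero_re] at this
          linarith
        have e : (fun t : ℝ => Complex.exp (-s * (t : ℂ)) *
            ((Real.exp (-(a / 2) * t) * (Real.sin (β * t) / β) : ℝ) : ℂ)) = fun t : ℝ =>
            (2 * β * Complex.I)⁻¹ * (Complex.exp (-s * (t : ℂ)) * Complex.exp (z * t) -
              Complex.exp (-s * (t : ℂ)) * Complex.exp (w * t)) := by
          ext t
          rw [ez, ew]
          push_cast
          field_simp
          ring
        rw [e, integral_const_mul, integral_sub iz iw, vz, vw, hprod]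
        have hzw : z - w = 2 * β * Complex.I := by rw [hz, hw]; ring
        rw [← hzw]
        have : z - w ≠ 0 := by rw [hzw]; simp [hβ']
        field_simp
        ring
    refine ⟨S1, ?_⟩
    have S2 : Stable (fun s => (s + a / 2) * (s ^ 2 + a * s + b)⁻¹) := by
      refine (stable_of_density (f := fun t => Real.exp (-(a / 2) * t) * Real.cos (β * t))
        (A := 1) hα (by fun_prop) ?_).congr fun s hs _ => ?_
      · intro t _
        rw [abs_mul, abs_of_pos (Real.exp_pos _), mul_comm]
        exact mul_le_mul_of_nonneg_right (Real.abs_cos_le_one _) (Real.exp_pos _).le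
      · obtain ⟨iz, vz⟩ := integral_exp_mul_exp (s := s) (z := z) (by rw [hzre]; linarith)
        obtain ⟨iw, vw⟩ := integral_exp_mul_exp (s := s) (z := w) (by rw [hwre]; linarith)
        have hsz : s - z ≠ 0 := fun h0 => by
          have := congrArg Complex.re h0
          rw [Complex.sub_re, hzre, Complex.zero_re] at this
          linarith
        have hsw : s - w ≠ 0 := fun h0 => by
          have := congrArg Complex.re h0
          rw [Complex.sub_re, hwre, Complex.zero_re] at this
          linarith
        have e : (fun t : ℝ => Complex.exp (-s * (t : ℂ)) *
            ((Real.exp (-(a / 2) * t) * Real.cos (β * t) : ℝ) : ℂ)) = fun t : ℝ =>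
            (2 : ℂ)⁻¹ * (Complex.exp (-s * (t : ℂ)) * Complex.exp (z * t) +
              Complex.exp (-s * (t : ℂ)) * Complex.exp (w * t)) := by
          ext t
          rw [ez, ew]
          push_cast
          ring
        rw [e, integral_const_mul, integral_add iz iw, vz, vw, hprod]
        have hzw : (a : ℂ) = -(z + w) := by rw [hz, hw]; ring
        rw [hzw]
        field_simp
        ring
    refine (S2.sub (S1.const_mul (a / 2))).congr fun s _ _ => ?_
    push_cast
    ring

theorem stable_sq_mul_quadratic {a b : ℝ} (ha : 0 < a) (hb : 0 < b) :
    Stable (fun s => s ^ 2 * (s ^ 2 + a * s + b)⁻¹) := by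
  obtain ⟨h0, h1⟩ := stable_quadratic ha hb
  refine (((Stable.const 1).sub (h1.const_mul a)).sub (h0.const_mul b)).congr fun s hs _ => ?_
  push_cast
  linear_combination mul_inv_cancel₀ (quadratic_ne_zero ha hb hs)

/-! ### Low-gain PI design for one integrating plant -/

/-- Integrating plant in series with a unit first-order lag. -/
theorem HasIntegrator.div_one_add {P : ℂ → ℂ} {g : ℝ} (hP : HasIntegrator P g) :
    HasIntegrator (fun s => P s * (1 + s)⁻¹) g := by
  have h1 : Stable (fun s => (s + ((1 : ℝ) : ℂ))⁻¹) := stable_inv_add one_pos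
  refine ((hP.mul h1).sub (h1.const_mul g)).congr fun s hs h0 => ?_
  have := add_ofReal_ne_zero hs one_pos
  push_cast at this ⊢
  rw [add_comm 1 s]
  field_simp
  ring

/-- The low-gain loop in the time scale of its crossover: a perturbed double integrator. -/
theorem closedLoopStable_of_small {P E C : ℂ → ℂ} {g k a b a₀ b₀ ε : ℝ} {N₀ N₁ N₂ N : ℝ≥0}
    (hg : 0 < g) (hk : 0 < k) (ha₀ : 0 < a₀) (hb₀ : 0 < b₀) (hε : 0 < ε)
    (hP : HasIntegrator P g)
    (hE : ∀ s : ℂ, 0 ≤ s.re → s ≠ 0 → P s * (1 + s)⁻¹ = g / s + E s)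
    (hC : ∀ s : ℂ, 0 ≤ s.re → s ≠ 0 → C s = -(k * (b + a * k / s)) * (1 + s)⁻¹)
    (h₀ : StableWith ε N₀ (fun s => (s ^ 2 + (g * b₀ : ℝ) * s + (g * a₀ : ℝ))⁻¹))
    (h₁ : StableWith ε N₁ (fun s => s * (s ^ 2 + (g * b₀ : ℝ) * s + (g * a₀ : ℝ))⁻¹))
    (h₂ : StableWith ε N₂ (fun s => s ^ 2 * (s ^ 2 + (g * b₀ : ℝ) * s + (g * a₀ : ℝ))⁻¹))
    (hN : StableWith ε N (fun s => E (k * s)))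
    (hsmall : ‖g * (b - b₀)‖₊ * N₁ + ‖g * (a - a₀)‖₊ * N₀ +
      (‖k * b‖₊ * N₂ + ‖k * a‖₊ * N₁) * N < 1) :
    ClosedLoopStable P C := by
  have hkc : (k : ℂ) ≠ 0 := by exact_mod_cast hk.ne'
  set q : ℂ → ℂ := fun s => s ^ 2 + (g * b₀ : ℝ) * s + (g * a₀ : ℝ) with hq
  have hq0 : ∀ s : ℂ, 0 ≤ s.re → q s ≠ 0 := fun s hs =>
    quadratic_ne_zero (mul_pos hg hb₀) (mul_pos hg ha₀) hs
  have hΔ := ((h₁.const_mul hε.le (g * (b - b₀))).add hε.le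
    (h₀.const_mul hε.le (g * (a - a₀)))).add hε.le
    (((h₂.const_mul hε.le (k * b)).add hε.le (h₁.const_mul hε.le (k * a))).mul hε.le hN)
  set Δ : ℂ → ℂ := fun s => ((g * (b - b₀) : ℝ) : ℂ) * (s * (q s)⁻¹) +
    ((g * (a - a₀) : ℝ) : ℂ) * (q s)⁻¹ + (((k * b : ℝ) : ℂ) * (s ^ 2 * (q s)⁻¹) +
      ((k * a : ℝ) : ℂ) * (s * (q s)⁻¹)) * E (k * s) with hΔdef
  have hne : ∀ s : ℂ, 0 ≤ s.re → s ≠ 0 → 1 + Δ s ≠ 0 := fun s hs h0 =>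
    hΔ.one_add_ne_zero hε.le hsmall hs h0
  have hinv : Stable (fun s => (1 + Δ s)⁻¹) := (hΔ.inv_one_add hε.le hsmall).stable hε
  have hks : ∀ s : ℂ, 0 ≤ s.re → s ≠ 0 → 0 ≤ ((k : ℂ) * s).re ∧ (k : ℂ) * s ≠ 0 :=
    fun s hs h0 => ⟨by simpa using mul_nonneg hk.le hs, mul_ne_zero hkc h0⟩
  -- After rescaling, `1 - P C` is the nominal loop `q / s²` times `1 + Δ`. The terms of `Δ` are the
  -- deviations of the gains from `a₀`, `b₀` and the non-integrating part `E` of the lagged plant;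
  -- the smallness hypothesis makes `1 + Δ` invertible.
  have key : ∀ s : ℂ, 0 ≤ s.re → s ≠ 0 →
      1 - P (k * s) * C (k * s) = q s * (1 + Δ s) / s ^ 2 := by
    intro s hs h0
    obtain ⟨hs', h0'⟩ := hks s hs h0
    have hqs := hq0 s hs
    have e1 : P (k * s) * C (k * s) =
        -(k * (b + a * k / (k * s))) * (P (k * s) * (1 + k * s)⁻¹) := by
      rw [hC _ hs' h0']
      ring
    have e2 : q s * (1 + Δ s) = q s + ((g * (b - b₀) : ℝ) : ℂ) * s + ((g * (a - a₀) : ℝ) : ℂ) +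
        (((k * b : ℝ) : ℂ) * s ^ 2 + ((k * a : ℝ) : ℂ) * s) * E (k * s) := by
      simp only [hΔdef]
      field_simp
      ring
    rw [e1, e2, hE _ hs' h0', hq]
    field_simp
    push_cast
    ring
  have keyinv : ∀ s : ℂ, 0 ≤ s.re → s ≠ 0 →
      (1 - P (k * s) * C (k * s))⁻¹ = s ^ 2 * (q s)⁻¹ * (1 + Δ s)⁻¹ := by
    intro s hs h0
    rw [key s hs h0, inv_div, div_eq_mul_inv, mul_inv, mul_assoc]
  have S1 : Stable (fun s => s * (q s)⁻¹) := h₁.stable hε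
  have S2 : Stable (fun s => s ^ 2 * (q s)⁻¹) := h₂.stable hε
  have lag : Stable (fun s => (1 + (k : ℂ) * s)⁻¹) := stable_inv_one_add_mul hk
  refine ⟨fun s hs h0 => ?_, Stable.of_comp_mul hk ?_, Stable.of_comp_mul hk ?_,
    Stable.of_comp_mul hk ?_⟩
  · have hs' : s = k * (((k⁻¹ : ℝ) : ℂ) * s) := by
      push_cast
      rw [← mul_assoc, mul_inv_cancel₀ hkc, one_mul]
    have r1 : 0 ≤ (((k⁻¹ : ℝ) : ℂ) * s).re := by
      simpa using mul_nonneg (inv_pos.2 hk).le hs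
    have r2 : ((k⁻¹ : ℝ) : ℂ) * s ≠ 0 := by simp [hkc, h0]
    rw [hs', key _ r1 r2]
    exact div_ne_zero (mul_ne_zero (hq0 _ r1) (hne _ r1 r2)) (pow_ne_zero 2 r2)
  · exact (S2.mul hinv).congr keyinv
  · refine (((S1.const_mul (g / k)).add ((hP.comp_mul hk).mul S2)).mul hinv).congr
      fun s hs h0 => ?_
    rw [keyinv s hs h0]
    push_cast
    field_simp
    ring
  · refine ((((S2.const_mul (-(k * b))).add (S1.const_mul (-(k * a)))).mul lag).mul hinv).congr
      fun s hs h0 => ?_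
    obtain ⟨hs', h0'⟩ := hks s hs h0
    rw [keyinv s hs h0, hC _ hs' h0']
    push_cast
    field_simp
    ring

/-- The modulus is `‖g + iωE‖ / ω`. On low frequencies the numerator is Lipschitz with constant `B +
M` and stays close to `g`, so it cannot compensate for the growth of the denominator. -/
theorem norm_integrator_add_strictAnti {E : ℂ → ℂ} {g B M w : ℝ} (hg : 0 < g)
    (hM : 0 ≤ M) (hB : ∀ u : ℝ, 0 < u → ‖E (Complex.I * u)‖ ≤ B)
    (hL : ∀ u v : ℝ, 0 < u → 0 < v → ‖E (Complex.I * u) - E (Complex.I * v)‖ ≤ M * |u - v|)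
    (hw : w ≤ 1) (hwg : 2 * (B + M) * w ≤ g) {u v : ℝ} (hu : 0 < u) (huv : u < v) (hv : v ≤ w) :
    ‖g / (Complex.I * v) + E (Complex.I * v)‖ < ‖g / (Complex.I * u) + E (Complex.I * u)‖ := by
  have hv0 : 0 < v := hu.trans huv
  have hB0 : 0 ≤ B := (norm_nonneg _).trans (hB u hu)
  have e : ∀ x : ℝ, 0 < x → ‖g / (Complex.I * x) + E (Complex.I * x)‖ =
      ‖g + Complex.I * x * E (Complex.I * x)‖ / x := by
    intro x hx
    have hx' : (x : ℂ) ≠ 0 := by exact_mod_cast hx.ne'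
    have h1 : (g : ℂ) / (Complex.I * x) + E (Complex.I * x) =
        (g + Complex.I * x * E (Complex.I * x)) / (Complex.I * x) := by
      field_simp
    rw [h1, norm_div, norm_mul, Complex.norm_I, one_mul, Complex.norm_real,
      Real.norm_of_nonneg hx.le]
  rw [e u hu, e v hv0, div_lt_div_iff₀ hv0 hu]
  set p := ‖(g : ℂ) + Complex.I * u * E (Complex.I * u)‖ with hp
  set q := ‖(g : ℂ) + Complex.I * v * E (Complex.I * v)‖ with hq
  have h1 : g - u * B ≤ p := by
    have a1 : ‖(g : ℂ)‖ ≤ p + ‖Complex.I * u * E (Complex.I * u)‖ := norm_le_add_norm_add _ _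
    rw [norm_mul, norm_mul, Complex.norm_I, one_mul, Complex.norm_real, Complex.norm_real,
      Real.norm_of_nonneg hg.le, Real.norm_of_nonneg hu.le] at a1
    have := mul_le_mul_of_nonneg_left (hB u hu) hu.le
    linarith
  have h2 : q - p ≤ (B + M) * (v - u) := by
    have a1 : q - p ≤ ‖Complex.I * v * E (Complex.I * v) - Complex.I * u * E (Complex.I * u)‖ := by
      refine (norm_sub_norm_le _ _).trans (le_of_eq ?_)
      congr 1
      ring
    have a2 : Complex.I * v * E (Complex.I * v) - Complex.I * u * E (Complex.I * u) =
        Complex.I * ((v - u : ℝ) : ℂ) * E (Complex.I * v) +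
          Complex.I * u * (E (Complex.I * v) - E (Complex.I * u)) := by
      push_cast
      ring
    rw [a2] at a1
    refine a1.trans ((norm_add_le _ _).trans ?_)
    simp only [norm_mul, Complex.norm_I, one_mul, Complex.norm_real]
    rw [Real.norm_of_nonneg hu.le, Real.norm_of_nonneg (sub_pos.2 huv).le]
    have a3 := hL v u hv0 hu
    rw [abs_of_pos (sub_pos.2 huv)] at a3
    have a4 : u * ‖E (Complex.I * v) - E (Complex.I * u)‖ ≤ 1 * (M * (v - u)) :=
      mul_le_mul (by linarith) a3 (norm_nonneg _) zero_le_one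
    have a5 := mul_le_mul_of_nonneg_left (hB v hv0) (sub_pos.2 huv).le
    linarith
  have h3 : 2 * (B + M) * u < g ∨ B + M = 0 := by
    rcases (add_nonneg hB0 hM).eq_or_lt with h | h
    · exact Or.inr h.symm
    · left
      nlinarith
  have h4 : 0 < g - u * B - u * (B + M) := by
    rcases h3 with h | h
    · nlinarith [mul_nonneg hu.le hM]
    · have : B = 0 := by linarith
      rw [h, this]
      linarith
  nlinarith [mul_pos (sub_pos.2 huv) h4, mul_le_mul_of_nonneg_left h2 hu.le,
    mul_le_mul_of_nonneg_right h1 (sub_pos.2 huv).le]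

theorem norm_PI_antitone (b c : ℝ) {u v : ℝ} (hu : 0 < u) (huv : u ≤ v) :
    ‖(b : ℂ) + c / (Complex.I * v)‖ ≤ ‖(b : ℂ) + c / (Complex.I * u)‖ := by
  have e : ∀ x : ℝ, 0 < x → ‖(b : ℂ) + c / (Complex.I * x)‖ ^ 2 = b ^ 2 + (c / x) ^ 2 := by
    intro x hx
    have h1 : (b : ℂ) + c / (Complex.I * x) = (b : ℝ) + ((-(c / x) : ℝ) : ℂ) * Complex.I := by
      have hx' : (x : ℂ) ≠ 0 := by exact_mod_cast hx.ne'
      push_cast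
      field_simp
      linear_combination (c : ℂ) * Complex.I_sq
    rw [h1, Complex.sq_norm, Complex.normSq_add_mul_I]
    ring
  refine (sq_le_sq₀ (norm_nonneg _) (norm_nonneg _)).1 ?_
  rw [e u hu, e v (hu.trans_le huv), div_pow, div_pow]
  have : c ^ 2 / v ^ 2 ≤ c ^ 2 / u ^ 2 := by
    gcongr
  linarith

/-- Low-gain PI control of an integrating plant, with prescribed phase margin. -/
theorem exists_PI_phaseMargin {P : ℂ → ℂ} {g φ : ℝ} (hg : 0 < g) (hP : HasIntegrator P g)
    (hφ₀ : 0 < φ) (hφ₁ : φ < 90) :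
    ∃ C, IsPI C ∧ ClosedLoopStable P C ∧ HasPhaseMargin P C φ := by
  set θ : ℝ := φ * (Real.pi / 180) with hθ
  have hθ0 : 0 < θ := by positivity
  have hθ1 : θ < Real.pi / 2 := by
    rw [hθ]
    nlinarith [Real.pi_pos]
  have hsin : 0 < Real.sin θ := Real.sin_pos_of_pos_of_lt_pi hθ0 (by linarith)
  have hcos : 0 < Real.cos θ := Real.cos_pos_of_mem_Ioo ⟨by linarith, hθ1⟩
  have hgc : (g : ℂ) ≠ 0 := by exact_mod_cast hg.ne'
  have hIre : ∀ u : ℝ, 0 ≤ (Complex.I * (u : ℂ)).re := fun u => by simp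
  have hIne : ∀ u : ℝ, 0 < u → Complex.I * (u : ℂ) ≠ 0 := fun u hu => by simp [hu.ne']
  obtain ⟨E, hEdef⟩ : ∃ E : ℂ → ℂ, E = fun s => P s * (1 + s)⁻¹ - g / s := ⟨_, rfl⟩
  have hEs : Stable E := by
    rw [hEdef]
    exact hP.div_one_add
  have hPE : ∀ s : ℂ, P s * (1 + s)⁻¹ = g / s + E s := fun s => by
    rw [hEdef]
    ring
  obtain ⟨B, hB0, hB⟩ := hEs.exists_norm_le
  have hB' : ∀ u : ℝ, 0 < u → ‖E (Complex.I * u)‖ ≤ B := fun u hu => hB _ (hIre u) (hIne u hu)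
  obtain ⟨M, hM0, hM⟩ := hEs.exists_lipschitz
  obtain ⟨w, hw0, hw1, hwg⟩ : ∃ w : ℝ, 0 < w ∧ w ≤ 1 ∧ 2 * (B + M) * w ≤ g := by
    refine ⟨min 1 (g / (2 * (B + M + 1))), lt_min one_pos (by positivity), min_le_left _ _, ?_⟩
    have h1 := min_le_right 1 (g / (2 * (B + M + 1)))
    have h2 : 0 < min 1 (g / (2 * (B + M + 1))) := lt_min one_pos (by positivity)
    rw [le_div_iff₀ (by positivity)] at h1
    nlinarith
  -- Limiting gains as the crossover tends to zero: at `s = i`, `(b₀ + a₀ / s) * (g / s)` equals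
  -- `-exp (iθ)`, which has modulus one and margin `θ`. Both gains are positive because `0 < θ < π /
  -- 2`.
  set a₀ := Real.cos θ / g with ha₀
  set b₀ := Real.sin θ / g with hb₀
  have ha₀p : 0 < a₀ := by positivity
  have hb₀p : 0 < b₀ := by positivity
  obtain ⟨s₀, s₁⟩ := stable_quadratic (mul_pos hg hb₀p) (mul_pos hg ha₀p)
  have s₂ := stable_sq_mul_quadratic (mul_pos hg hb₀p) (mul_pos hg ha₀p)
  obtain ⟨ε₀, hε₀, N₀, hN₀⟩ := s₀.exists_stableWith
  obtain ⟨ε₁, hε₁, N₁, hN₁⟩ := s₁.exists_stableWith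
  obtain ⟨ε₂, hε₂, N₂, hN₂⟩ := s₂.exists_stableWith
  obtain ⟨ε₃, hε₃, N, hN⟩ := hEs.exists_stableWith
  set ε := min (min ε₀ ε₁) (min ε₂ ε₃) with hε
  have hεp : 0 < ε := lt_min (lt_min hε₀ hε₁) (lt_min hε₂ hε₃)
  -- the frequency response, normalised by the integrator, as the crossover tends to zero
  let z : ℝ → ℂ := fun k => g + Complex.I * k * E (Complex.I * k)
  have hz : Tendsto z (𝓝[>] 0) (𝓝 g) := by
    rw [tendsto_iff_norm_sub_tendsto_zero]
    have h1 : Tendsto (fun k : ℝ => k * B) (𝓝[>] 0) (𝓝 0) := by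
      have : Tendsto (fun k : ℝ => k * B) (𝓝 0) (𝓝 (0 * B)) := by
        exact (continuous_id.mul continuous_const).tendsto 0
      rw [zero_mul] at this
      exact this.mono_left nhdsWithin_le_nhds
    refine squeeze_zero' (Eventually.of_forall fun _ => norm_nonneg _) ?_ h1
    filter_upwards [self_mem_nhdsWithin] with k hk
    have hk : 0 < k := hk
    simp only [z, add_sub_cancel_left, norm_mul, Complex.norm_I, one_mul, Complex.norm_real]
    rw [Real.norm_of_nonneg hk.le]
    exact mul_le_mul_of_nonneg_left (hB' k hk) hk.le
  -- The gains are read off from `a + i b = W k`. The loop at frequency `k` is `(a + i b) z k`, so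
  -- this choice makes its modulus one and its phase correct exactly, not merely in the limit.
  let W : ℝ → ℂ := fun k => Complex.exp (θ * Complex.I) / z k
  have hW : Tendsto W (𝓝[>] 0) (𝓝 (Complex.exp (θ * Complex.I) / g)) :=
    tendsto_const_nhds.div hz hgc
  have hW0 : Complex.exp (θ * Complex.I) / g = (a₀ : ℂ) + b₀ * Complex.I := by
    rw [Complex.exp_mul_I, ← Complex.ofReal_cos, ← Complex.ofReal_sin, ha₀, hb₀]
    push_cast
    field_simp
  rw [hW0] at hW
  have ha : Tendsto (fun k => (W k).re) (𝓝[>] 0) (𝓝 a₀) := by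
    simpa [Function.comp_def] using (Complex.continuous_re.tendsto _).comp hW
  have hb : Tendsto (fun k => (W k).im) (𝓝[>] 0) (𝓝 b₀) := by
    simpa [Function.comp_def] using (Complex.continuous_im.tendsto _).comp hW
  have hid : Tendsto (fun k : ℝ => k) (𝓝[>] 0) (𝓝 0) :=
    tendsto_id.mono_left nhdsWithin_le_nhds
  have hsmall : Tendsto (fun k : ℝ => ‖g * ((W k).im - b₀)‖₊ * N₁ + ‖g * ((W k).re - a₀)‖₊ * N₀ +
      (‖k * (W k).im‖₊ * N₂ + ‖k * (W k).re‖₊ * N₁) * N) (𝓝[>] 0) (𝓝 0) := by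
    have t1 := (((hb.sub_const b₀).const_mul g).nnnorm).mul_const N₁
    have t2 := (((ha.sub_const a₀).const_mul g).nnnorm).mul_const N₀
    have t3 := ((hid.mul hb).nnnorm).mul_const N₂
    have t4 := ((hid.mul ha).nnnorm).mul_const N₁
    have := (t1.add t2).add ((t3.add t4).mul_const N)
    simpa using this
  -- This expression dominates the loop gain at all frequencies above `w`, so for small `k` no
  -- crossover occurs there.
  have hgain : Tendsto (fun k : ℝ => k * ((W k).im + (W k).re * k / w) * (g / w + B))
      (𝓝[>] 0) (𝓝 0) := by
    have := (hid.mul (hb.add ((ha.mul hid).div_const w))).mul_const (g / w + B)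
    simpa using this
  have hpos0 : ∀ᶠ k in 𝓝[>] (0 : ℝ), 0 < k := self_mem_nhdsWithin
  obtain ⟨k, ⟨⟨⟨⟨⟨⟨hkp, hkz⟩, hka⟩, hkb⟩, hks⟩, hkg⟩, hkw⟩⟩ :=
    ((((((hpos0.and
      (hz.eventually_ne hgc)).and (ha.eventually_const_lt ha₀p)).and
      (hb.eventually_const_lt hb₀p)).and (hsmall.eventually_lt_const one_pos)).and
      (hgain.eventually_lt_const one_pos)).and (hid.eventually_lt_const hw0)).exists
  have hkc : (k : ℂ) ≠ 0 := by exact_mod_cast hkp.ne'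
  set a := (W k).re with hadef
  set b := (W k).im with hbdef
  have hac : (a : ℂ) ≠ 0 := by exact_mod_cast hka.ne'
  have hbc : (b : ℂ) ≠ 0 := by exact_mod_cast hkb.ne'
  have hWk : ((a : ℂ) + b * Complex.I) * z k = Complex.exp (θ * Complex.I) := by
    rw [hadef, hbdef, Complex.re_add_im]
    exact div_mul_cancel₀ _ hkz
  -- The parameters are chosen so that the PI factor is `k (b + a k / s)`; the filter has unit time
  -- constant.
  let C : ℂ → ℂ := fun s => -((k * b : ℝ) : ℂ) * (1 + 1 / (((b / (a * k) : ℝ) : ℂ) * s)) *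
    (1 / (1 + ((1 : ℝ) : ℂ) * s))
  have hC : ∀ s : ℂ, s ≠ 0 → C s = -(k * (b + a * k / s)) * (1 + s)⁻¹ := by
    intro s h0
    simp only [C]
    push_cast
    rw [one_mul, one_div (1 + s)]
    congr 1
    field_simp
  refine ⟨C, ⟨k * b, b / (a * k), 1, by positivity, by positivity, one_pos, fun s => rfl⟩, ?_, ?_⟩
  · refine closedLoopStable_of_small (a := a) (b := b) hg hkp ha₀p hb₀p hεp hP
      (fun s _ _ => hPE s) (fun s _ h0 => hC s h0)
      (hN₀.mono ((min_le_left _ _).trans (min_le_left _ _)) le_rfl)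
      (hN₁.mono ((min_le_left _ _).trans (min_le_right _ _)) le_rfl)
      (hN₂.mono ((min_le_right _ _).trans (min_le_left _ _)) le_rfl)
      (StableWith.comp_mul hkp (hN.mono ?_ le_rfl)) hks
    -- Since `k ≤ 1`, rescaling `E` can only improve its decay rate, so the bound `N` does not
    -- depend on `k`.
    calc ε * k ≤ ε * 1 := mul_le_mul_of_nonneg_left (hkw.le.trans hw1) hεp.le
      _ ≤ ε₃ := by
        rw [mul_one]
        exact (min_le_right _ _).trans (min_le_right _ _)
  · have hPC : ∀ u : ℝ, 0 < u → P (Complex.I * u) * C (Complex.I * u) =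
        -(k * (b + ((a * k : ℝ) : ℂ) / (Complex.I * u))) *
          (g / (Complex.I * u) + E (Complex.I * u)) := by
      intro u hu
      rw [hC _ (hIne u hu), ← hPE]
      push_cast
      ring
    have hnorm : ∀ u : ℝ, 0 < u → ‖P (Complex.I * u) * C (Complex.I * u)‖ =
        k * (‖(b : ℂ) + ((a * k : ℝ) : ℂ) / (Complex.I * u)‖ *
          ‖g / (Complex.I * u) + E (Complex.I * u)‖) := by
      intro u hu
      rw [hPC u hu, norm_mul, norm_neg, norm_mul, Complex.norm_real, Real.norm_of_nonneg hkp.le,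
        mul_assoc]
    have hphase : -(P (Complex.I * k) * C (Complex.I * k)) =
        Complex.exp ((((-180 + φ) * (Real.pi / 180) : ℝ) : ℂ) * Complex.I) := by
      have e1 : ((((-180 + φ) * (Real.pi / 180) : ℝ) : ℂ) * Complex.I) =
          θ * Complex.I - Real.pi * Complex.I := by
        rw [hθ]
        push_cast
        ring
      rw [e1, Complex.exp_sub, Complex.exp_pi_mul_I, ← hWk, hPC k hkp]
      simp only [z]
      push_cast
      field_simp
      rw [Complex.I_sq]
      ring
    have hk1 : ‖P (Complex.I * k) * C (Complex.I * k)‖ = 1 := by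
      rw [← norm_neg, hphase, Complex.norm_exp_ofReal_mul_I]
    have hpos : ∀ u : ℝ, 0 < u → 0 < ‖(b : ℂ) + ((a * k : ℝ) : ℂ) / (Complex.I * u)‖ := by
      intro u hu
      rw [norm_pos_iff]
      intro h
      have h1 := congrArg Complex.re h
      simp [Complex.div_re] at h1
      linarith
    have hanti : ∀ u v : ℝ, 0 < u → u < v → v ≤ w →
        ‖P (Complex.I * v) * C (Complex.I * v)‖ < ‖P (Complex.I * u) * C (Complex.I * u)‖ := by
      intro u v hu huv hv
      rw [hnorm u hu, hnorm v (hu.trans huv)]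
      refine mul_lt_mul_of_pos_left ?_ hkp
      exact mul_lt_mul_of_le_of_lt_of_nonneg_of_pos (norm_PI_antitone b (a * k) hu huv.le)
        (norm_integrator_add_strictAnti hg hM0 hB' hM hw1 hwg hu huv hv) (norm_nonneg _) (hpos u hu)
    refine ⟨k, hkp, fun u hu => ⟨fun h => ?_, fun h => h ▸ hk1⟩, hphase⟩
    -- Up to `w` the loop gain is strictly decreasing, so it equals one only at `k`; beyond `w` it
    -- is below one by `hkg`.
    rcases le_or_gt u w with huw | huw
    · rcases lt_trichotomy u k with h1 | h1 | h1
      · have := hanti u k hu h1 hkw.le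
        rw [h, hk1] at this
        exact absurd this (lt_irrefl _)
      · exact h1
      · have := hanti k u hkp h1 huw
        rw [h, hk1] at this
        exact absurd this (lt_irrefl _)
    · exfalso
      have n1 : ‖(b : ℂ) + ((a * k : ℝ) : ℂ) / (Complex.I * u)‖ ≤ b + a * k / w := by
        refine (norm_add_le _ _).trans ?_
        rw [norm_div, norm_mul, Complex.norm_I, one_mul, Complex.norm_real, Complex.norm_real,
          Complex.norm_real, Real.norm_of_nonneg hkb.le, Real.norm_of_nonneg (by positivity),
          Real.norm_of_nonneg hu.le]
        gcongr
      have n2 : ‖g / (Complex.I * u) + E (Complex.I * u)‖ ≤ g / w + B := by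
        refine (norm_add_le _ _).trans (add_le_add ?_ (hB' u hu))
        rw [norm_div, norm_mul, Complex.norm_I, one_mul, Complex.norm_real, Complex.norm_real,
          Real.norm_of_nonneg hg.le, Real.norm_of_nonneg hu.le]
        gcongr
      have n3 := mul_le_mul n1 n2 (norm_nonneg _) (by positivity)
      have n4 := mul_le_mul_of_nonneg_left n3 hkp.le
      rw [← hnorm u hu, h, ← mul_assoc] at n4
      linarith

/-! ### Behaviour at the origin when a loop is closed -/

theorem HasIntegrator.neg {F : ℂ → ℂ} {a : ℝ} (hF : HasIntegrator F a) :
    HasIntegrator (fun s => -F s) (-a) :=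
  (Stable.neg hF).congr fun s _ _ => by push_cast; ring

theorem HasIntegrator.sub {F G : ℂ → ℂ} {a b : ℝ} (hF : HasIntegrator F a)
    (hG : HasIntegrator G b) : HasIntegrator (fun s => F s - G s) (a - b) :=
  (Stable.sub hF hG).congr fun s _ _ => by push_cast; ring

theorem HasIntegrator.congr {F G : ℂ → ℂ} {a : ℝ} (hF : HasIntegrator F a)
    (h : ∀ s : ℂ, 0 ≤ s.re → s ≠ 0 → G s = F s) : HasIntegrator G a :=
  Stable.congr hF fun s hs h0 => by rw [h s hs h0]

theorem HasIntegrator.zero : HasIntegrator (fun _ => 0) 0 :=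
  (Stable.const 0).congr fun s _ _ => by simp

theorem hasIntegrator_zero_iff {F : ℂ → ℂ} : HasIntegrator F 0 ↔ Stable F := by
  simp [HasIntegrator]

theorem one_add_mul_ne_zero {s : ℂ} (hs : 0 ≤ s.re) {r : ℝ} (hr : 0 < r) : 1 + r * s ≠ 0 := by
  intro h
  have := congrArg Complex.re h
  simp at this
  nlinarith [mul_nonneg hr.le hs]

theorem stable_lead_lag {p q : ℝ} (hq : 0 < q) :
    Stable (fun s => (1 + p * s) * (1 + q * s)⁻¹) := by
  refine ((Stable.const (p / q)).add
    ((stable_inv_one_add_mul hq).const_mul (1 - p / q))).congr fun s hs _ => ?_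
  have h1 := mul_inv_cancel₀ (one_add_mul_ne_zero hs hq)
  have h2 : (q : ℂ)⁻¹ * q = 1 := inv_mul_cancel₀ (by exact_mod_cast hq.ne')
  push_cast
  linear_combination ((p : ℂ) / q) * h1 - p * s * (1 + q * s)⁻¹ * h2

/-- A stable PI loop around an integrating plant: the sensitivity has a double zero at the origin,
and the control sensitivity is there asymptotic to `-s / g`. -/
theorem ClosedLoopStable.sensitivity_bounds {P C : ℂ → ℂ} {g : ℝ} (hg : g ≠ 0)
    (hP : HasIntegrator P g) (hC : IsPI C) (h : ClosedLoopStable P C) :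
    Stable (fun s => C s * (1 - P s * C s)⁻¹ / s) ∧
    Stable (fun s => (1 - P s * C s)⁻¹ / s) ∧
    Stable (fun s => (1 - P s * C s)⁻¹ / s ^ 2) ∧
    Stable (fun s => C s * (1 - P s * C s)⁻¹ / s ^ 2 + 1 / (g * s)) := by
  obtain ⟨hne, hT, -, hQ⟩ := h
  have hgg : (g : ℂ)⁻¹ * g = 1 := inv_mul_cancel₀ (by exact_mod_cast hg)
  have hτ : ∀ s : ℂ, 0 ≤ s.re → s ≠ 0 → (1 - P s * C s) * (1 - P s * C s)⁻¹ = 1 :=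
    fun s hs h0 => mul_inv_cancel₀ (hne s hs h0)
  -- With `T` the sensitivity, `T - 1 = P C T`. Splitting off the integrator of `P` expresses `g C T
  -- / s` by stable terms.
  have hR : Stable (fun s => C s * (1 - P s * C s)⁻¹ / s) := by
    refine (((hT.sub (Stable.const 1)).sub (Stable.mul hP hQ)).const_mul g⁻¹).congr
      fun s hs h0 => ?_
    push_cast
    linear_combination (-(g : ℂ)⁻¹) * hτ s hs h0 - (C s * (1 - P s * C s)⁻¹ / s) * hgg
  obtain ⟨K, TI, TF, hK, hTI, hTF, hCs⟩ := hC
  have hKc : (K : ℂ) ≠ 0 := by exact_mod_cast hK.ne'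
  have hTIc : (TI : ℂ) ≠ 0 := by exact_mod_cast hTI.ne'
  -- `T` is `C T` times `1 / C`, and the integrator of the compensator makes `1 / C` supply a
  -- further zero at the origin.
  have hTeq : ∀ s : ℂ, 0 ≤ s.re → s ≠ 0 → (1 - P s * C s)⁻¹ =
      -(TI / K) * s * (C s * (1 - P s * C s)⁻¹) * ((1 + TF * s) * (1 + TI * s)⁻¹) := by
    intro s hs h0
    have h1 := one_add_mul_ne_zero hs hTI
    have h2 := one_add_mul_ne_zero hs hTF
    have h3 : -(TI / K) * s * C s * ((1 + TF * s) * (1 + TI * s)⁻¹) = (1 : ℂ) := by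
      have h4 : (1 : ℂ) + 1 / (TI * s) = (1 + TI * s) / (TI * s) := by
        field_simp
        ring
      rw [hCs, h4]
      generalize (1 : ℂ) + TI * s = y at *
      generalize (1 : ℂ) + TF * s = x at *
      field_simp
    linear_combination (-(1 - P s * C s)⁻¹) * h3
  have hTs : Stable (fun s => (1 - P s * C s)⁻¹ / s) := by
    refine ((hQ.mul (stable_lead_lag (p := TF) hTI)).const_mul (-(TI / K))).congr fun s hs h0 => ?_
    rw [div_eq_iff h0]
    push_cast
    linear_combination hTeq s hs h0
  refine ⟨hR, hTs, ?_, ?_⟩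
  · refine ((hR.mul (stable_lead_lag (p := TF) hTI)).const_mul (-(TI / K))).congr fun s hs h0 => ?_
    rw [div_eq_iff (pow_ne_zero 2 h0)]
    push_cast
    linear_combination hTeq s hs h0 + (TI / K : ℂ) * (C s * (1 - P s * C s)⁻¹) *
      ((1 + TF * s) * (1 + TI * s)⁻¹) * s * (inv_mul_cancel₀ h0)
  · refine ((hTs.sub (Stable.mul hP hR)).const_mul g⁻¹).congr fun s hs h0 => ?_
    push_cast
    linear_combination (-((g : ℂ)⁻¹ * s⁻¹)) * hτ s hs h0 -
      (C s * (1 - P s * C s)⁻¹ / s ^ 2) * hgg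

/-- Rows marked `closed` vanish at the origin; all entries have at most one integrator. -/
structure IntegratorMatrix {ι κ : Type*} (closed : ι → Prop) (X : ℂ → Matrix ι κ ℂ)
    (g : Matrix ι κ ℝ) : Prop where
  integrator : ∀ k l, HasIntegrator (fun s => X s k l) (g k l)
  gain_eq_zero : ∀ k l, closed k → g k l = 0
  stable_div : ∀ k l, closed k → Stable (fun s => X s k l / s)

/-- Closing one more stable PI loop. -/
theorem IntegratorMatrix.close {ι κ : Type*} {closed : ι → Prop}
    {H : ℂ → Matrix ι ι ℂ} {X X' : ℂ → Matrix ι κ ℂ} {g : Matrix ι ι ℝ} {f : Matrix ι κ ℝ}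
    {C : ℂ → ℂ} {m : ι} (hH : IntegratorMatrix closed H g) (hX : IntegratorMatrix closed X f)
    (hg : g m m ≠ 0) (hC : IsPI C) (hst : ClosedLoopStable (fun s => H s m m) C)
    (hX' : ∀ s : ℂ, 0 ≤ s.re → s ≠ 0 → ∀ k l,
      X' s k l = X s k l + H s k m * (C s * (1 - H s m m * C s)⁻¹) * X s m l) :
    IntegratorMatrix (fun k => closed k ∨ k = m) X'
      (Matrix.of fun k l => f k l - g k m * f m l / g m m) := by
  obtain ⟨hR, hT, hT2, hR2⟩ := hst.sensitivity_bounds hg (hH.integrator m m) hC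
  obtain ⟨hne, -, -, hQ⟩ := hst
  have hgc : (g m m : ℂ) ≠ 0 := by exact_mod_cast hg
  refine ⟨fun k l => ?_, fun k l hk => ?_, fun k l hk => ?_⟩
  -- The two integrators around the control sensitivity `Q` would give a double pole. As `Q` behaves
  -- like `-s / g m m` at the origin, one simple pole is left, and its residue is the Schur
  -- correction.
  · have hy := hX.integrator k l
    have ha := hH.integrator k m
    have hx := hX.integrator m l
    refine ((((Stable.add hy ((Stable.mul ha hQ).mul hx)).add
      ((hR.mul hx).const_mul (g k m))).add ((Stable.mul ha hR).const_mul (f m l))).add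
      (hR2.const_mul (g k m * f m l))).congr fun s hs h0 => ?_
    simp only [Matrix.of_apply, hX' s hs h0]
    generalize (1 - H s m m * C s)⁻¹ = τ
    push_cast
    field_simp
    ring
  · rcases hk with hk | rfl
    · simp [hX.gain_eq_zero k l hk, hH.gain_eq_zero k m hk]
    · simp only [Matrix.of_apply]
      field_simp
      ring
  · have hx := hX.integrator m l
    rcases hk with hk | rfl
    · refine ((hX.stable_div k l hk).add ((hH.stable_div k m hk).mul
        ((Stable.mul hQ hx).add (hR.const_mul (f m l))))).congr fun s hs h0 => ?_
      rw [hX' s hs h0]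
      field_simp
      ring
    -- In the row being closed the factor `1 + H m m * Q` is the sensitivity itself; its double zero
    -- absorbs both the integrator and the division by `s`.
    · refine ((Stable.mul hT hx).add (hT2.const_mul (f k l))).congr fun s hs h0 => ?_
      have := hne s hs h0
      rw [hX' s hs h0]
      field_simp
      ring

/-! ### Rank-one update of the loop matrix -/

section RankOne

variable {ι : Type*} [Fintype ι] [DecidableEq ι]

/-- Sherman–Morrison: the update factors as `L * (1 - γ H D)` with `D` the projection on coordinate
`m`, and `(H D)² = H m m • (H D)`, so the second factor is inverted as in the scalar case. -/
theorem isUnit_sub_mul_single {L G : Matrix ι ι ℂ} (hL : IsUnit L) (m : ι) {γ : ℂ}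
    (hne : 1 - (L⁻¹ * G) m m * γ ≠ 0) :
    IsUnit (L - G * Matrix.diagonal (Pi.single m γ)) ∧
    ∀ {κ : Type*} (W : Matrix ι κ ℂ) (k : ι) (l : κ),
      ((L - G * Matrix.diagonal (Pi.single m γ))⁻¹ * W) k l = (L⁻¹ * W) k l +
        (L⁻¹ * G) k m * (γ * (1 - (L⁻¹ * G) m m * γ)⁻¹) * (L⁻¹ * W) m l := by
  have hdet : IsUnit L.det := (Matrix.isUnit_iff_isUnit_det L).1 hL
  set H := L⁻¹ * G with hH
  set t := 1 - H m m * γ with ht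
  have hLH : L * H = G := by rw [hH, Matrix.mul_nonsing_inv_cancel_left _ _ hdet]
  let D : Matrix ι ι ℂ := Matrix.diagonal (Pi.single m 1)
  have hDγ : ∀ c : ℂ, Matrix.diagonal (Pi.single m c) = c • D := by
    intro c
    rw [← Matrix.diagonal_smul, ← Pi.single_smul, smul_eq_mul, mul_one]
  have hDHD : D * H * D = H m m • D := by
    ext i j
    rw [Matrix.mul_diagonal, Matrix.diagonal_mul]
    by_cases hi : i = m
    · subst hi
      by_cases hj : i = j
      · subst hj
        simp [D]
      · simp [D, Matrix.diagonal_apply_ne _ hj, Pi.single_eq_of_ne (Ne.symm hj)]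
    · by_cases hj : i = j
      · subst hj
        simp [D, hi]
      · simp [D, hi, Matrix.diagonal_apply_ne _ hj]
  have hfac : L - G * Matrix.diagonal (Pi.single m γ) = L * (1 - γ • (H * D)) := by
    rw [hDγ, Matrix.mul_sub, Matrix.mul_one, Matrix.mul_smul, Matrix.mul_smul, ← Matrix.mul_assoc,
      hLH]
  have hDH : H * D * (H * D) = H m m • (H * D) := by
    rw [Matrix.mul_assoc, ← Matrix.mul_assoc D, hDHD, Matrix.mul_smul]
  have hinv : (1 - γ • (H * D)) * (1 + (γ * t⁻¹) • (H * D)) = 1 := by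
    have h1 : γ * t⁻¹ - γ - γ * (γ * t⁻¹) * H m m = 0 := by
      field_simp
      rw [ht]
      ring
    have h2 : (1 - γ • (H * D)) * (1 + (γ * t⁻¹) • (H * D)) =
        1 + (γ * t⁻¹ - γ - γ * (γ * t⁻¹) * H m m) • (H * D) := by
      rw [Matrix.sub_mul, Matrix.one_mul, Matrix.mul_add, Matrix.mul_one, Matrix.smul_mul,
        Matrix.mul_smul, hDH]
      module
    rw [h2, h1, zero_smul, add_zero]
  have hu : IsUnit (1 - γ • (H * D)) :=
    (Matrix.isUnit_iff_isUnit_det _).2 (Matrix.isUnit_det_of_right_inverse hinv)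
  rw [hfac]
  refine ⟨hL.mul hu, fun {κ} W k l => ?_⟩
  rw [Matrix.mul_inv_rev, Matrix.inv_eq_right_inv hinv, Matrix.mul_assoc, Matrix.add_mul,
    Matrix.one_mul, Matrix.add_apply, Matrix.smul_mul, Matrix.smul_apply, Matrix.mul_assoc H]
  congr 1
  rw [Matrix.mul_apply, Finset.sum_eq_single m]
  · simp [D, Matrix.diagonal_mul]
    ring
  · intro j _ hj
    simp [D, Matrix.diagonal_mul, hj]
  · simp

end RankOne

section Design

open Matrix

theorem ClosedLoopStable.congr {P P' C : ℂ → ℂ} (h : ClosedLoopStable P C)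
    (e : ∀ s : ℂ, 0 ≤ s.re → s ≠ 0 → P' s = P s) : ClosedLoopStable P' C := by
  obtain ⟨h1, h2, h3, h4⟩ := h
  exact ⟨fun s hs h0 => by rw [e s hs h0]; exact h1 s hs h0,
    h2.congr fun s hs h0 => by rw [e s hs h0], h3.congr fun s hs h0 => by rw [e s hs h0],
    h4.congr fun s hs h0 => by rw [e s hs h0]⟩

/-! ### Positivity of the residue matrices -/

section Gains

variable {ι : Type*} [Fintype ι] [DecidableEq ι]

/-- Positivity of the quadratic form of `g` on the vectors supported off `closed`. -/
def PositiveOff (closed : ι → Prop) (g : Matrix ι ι ℝ) : Prop :=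
  ∀ x : ι → ℝ, (∀ j, closed j → x j = 0) → x ≠ 0 → 0 < x ⬝ᵥ g *ᵥ x

theorem PositiveOff.diag_pos {closed : ι → Prop} {g : Matrix ι ι ℝ} (h : PositiveOff closed g)
    {m : ι} (hm : ¬ closed m) : 0 < g m m := by
  have := h (Pi.single m 1) (fun j hj => ?_) (by simp)
  · simpa using this
  · rw [Pi.single_eq_of_ne]
    rintro rfl
    exact hm hj

/-- Schur complements of positive forms are positive. -/
theorem PositiveOff.schur {closed : ι → Prop} {g : Matrix ι ι ℝ} (h : PositiveOff closed g)
    {m : ι} (hm : ¬ closed m) : PositiveOff (fun k => closed k ∨ k = m)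
      (Matrix.of fun k l => g k l - g k m * g m l / g m m) := by
  intro x hx hx0
  have hg := h.diag_pos hm
  set α := (g *ᵥ x) m with hα
  set β := x ⬝ᵥ g.col m with hβ
  -- Symmetry of `g` is not assumed, so this is not a minimisation. The value makes coordinate `m`
  -- of `g (x + t eₘ)` vanish, which turns the form of `g` there into the form of the Schur
  -- complement at `x`.
  set t := -α / g m m with ht
  have h1 := h (x + t • Pi.single m 1) (fun j hj => ?_) (fun h0 => ?_)
  · have h2 : (x + t • Pi.single m 1) ⬝ᵥ g *ᵥ (x + t • Pi.single m 1) =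
        x ⬝ᵥ g *ᵥ x + t * α + t * β + t * t * g m m := by
      rw [mulVec_add, mulVec_smul, mulVec_single_one, add_dotProduct, dotProduct_add,
        dotProduct_add, smul_dotProduct, smul_dotProduct, single_dotProduct, single_dotProduct,
        dotProduct_smul]
      simp only [Matrix.col_apply, Pi.smul_apply, smul_eq_mul, one_mul]
      ring
    have h3 : x ⬝ᵥ (Matrix.of fun k l => g k l - g k m * g m l / g m m) *ᵥ x =
        x ⬝ᵥ g *ᵥ x - β * α / g m m := by
      have e : (Matrix.of fun k l => g k l - g k m * g m l / g m m) *ᵥ x =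
          g *ᵥ x - (α / g m m) • g.col m := by
        ext k
        simp only [mulVec, dotProduct, Matrix.of_apply, Pi.sub_apply, Pi.smul_apply, hα,
          Matrix.col_apply, smul_eq_mul, sub_mul, Finset.sum_sub_distrib, Finset.sum_div,
          Finset.sum_mul]
        congr 1
        refine Finset.sum_congr rfl fun l _ => ?_
        ring
      rw [e, dotProduct_sub, dotProduct_smul, smul_eq_mul]
      ring
    rw [h3]
    rw [h2] at h1
    have h4 : x ⬝ᵥ g *ᵥ x + t * α + t * β + t * t * g m m = x ⬝ᵥ g *ᵥ x - β * α / g m m := by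
      rw [ht]
      field_simp
      ring
    rwa [h4] at h1
  · have : j ≠ m := by
      rintro rfl
      exact hm hj
    simp [hx j (Or.inl hj), this]
  · apply hx0
    ext j
    by_cases hj : j = m
    · exact hx j (Or.inr hj)
    · simpa [hj] using congrFun h0 j

end Gains

variable {n : ℕ}

/-- Residue matrix of the plant at the origin. -/
def plantGain (c : Fin (n + 1) → ℝ) : Matrix (Fin n) (Fin n) ℝ :=
  Matrix.of fun i j =>
    if j = i then 1 / c i.succ + 1 / c i.castSucc
    else if (j : ℕ) = i + 1 then -(1 / c i.succ)
    else if (i : ℕ) = j + 1 then -(1 / c i.castSucc)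
    else 0

/-- Incidence matrix between pools and gates. -/
def incidence (n : ℕ) : Matrix (Fin (n + 1)) (Fin n) ℝ :=
  Matrix.of fun j i => (if j = i.succ then 1 else 0) - (if j = i.castSucc then 1 else 0)

theorem plantGain_eq (c : Fin (n + 1) → ℝ) :
    plantGain c = (incidence n)ᵀ * (Matrix.diagonal (fun j => 1 / c j) * incidence n) := by
  ext i k
  rw [Matrix.mul_apply]
  simp only [plantGain, incidence, Matrix.of_apply, Matrix.diagonal_mul,
    Matrix.transpose_apply, sub_mul, ite_mul, one_mul, zero_mul, Finset.sum_sub_distrib,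
    Finset.sum_ite_eq', Finset.mem_univ, if_true]
  simp only [Fin.ext_iff, Fin.val_succ, Fin.val_castSucc]
  split_ifs <;> first | omega | ring

/-- The pools form a path: the first pool touches only the first gate, and balance in each next pool
passes the vanishing flow on to the next gate. -/
theorem incidence_mulVec_eq_zero {x : Fin n → ℝ} (h : incidence n *ᵥ x = 0) : x = 0 := by
  have key : ∀ (N : ℕ) (i : Fin n), (i : ℕ) = N → x i = 0 := by
    intro N
    induction N using Nat.strong_induction_on with
    | _ N ih =>
      intro i hi
      have h1 := congrFun h i.castSucc
      simp only [mulVec, dotProduct, incidence, Matrix.of_apply, sub_mul, ite_mul, one_mul,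
        zero_mul, Finset.sum_sub_distrib, Pi.zero_apply, Fin.castSucc_inj, Finset.sum_ite_eq,
        Finset.mem_univ, if_true] at h1
      rw [Finset.sum_eq_zero] at h1
      · linarith
      · intro j _
        split_ifs with hj
        · have hj' := congrArg Fin.val hj
          simp only [Fin.val_succ, Fin.val_castSucc] at hj'
          exact ih j (by omega) j rfl
        · rfl
  ext i
  exact key i i rfl

theorem plantGain_positive {c : Fin (n + 1) → ℝ} (hc : ∀ j, 0 < c j) :
    PositiveOff (fun _ => False) (plantGain c) := by
  intro x _ hx0
  set v := incidence n *ᵥ x with hv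
  have hv0 : v ≠ 0 := fun h => hx0 (incidence_mulVec_eq_zero h)
  have e : x ⬝ᵥ plantGain c *ᵥ x = ∑ j, 1 / c j * v j ^ 2 := by
    rw [plantGain_eq, ← mulVec_mulVec, ← mulVec_mulVec, ← hv, dotProduct_mulVec, vecMul_transpose,
      ← hv, dotProduct]
    refine Finset.sum_congr rfl fun j _ => ?_
    rw [mulVec_diagonal]
    ring
  rw [e]
  obtain ⟨j, hj⟩ := Function.ne_iff.1 hv0
  have hj : v j ≠ 0 := hj
  refine Finset.sum_pos' (fun i _ => ?_) ⟨j, Finset.mem_univ _, ?_⟩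
  · have := hc i
    positivity
  · have := hc j
    positivity

theorem plant_integrator {Gin Gout : Fin (n + 1) → ℂ → ℂ} {c : Fin (n + 1) → ℝ}
    (hin : ∀ j, HasIntegrator (Gin j) (1 / c j))
    (hout : ∀ j, HasIntegrator (Gout j) (-(1 / c j))) (i j : Fin n) :
    HasIntegrator (fun s => plant Gin Gout s i j) (plantGain c i j) := by
  simp only [plant, plantGain, Matrix.of_apply]
  split_ifs
  · simpa using (hin i.succ).sub (hout i.castSucc)
  · exact hout i.succ
  · exact (hin i.castSucc).neg
  · exact HasIntegrator.zero

theorem disturbancePlant_integrator {Gin Gout : Fin (n + 1) → ℂ → ℂ} {c : Fin (n + 1) → ℝ}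
    (hin : ∀ j, HasIntegrator (Gin j) (1 / c j))
    (hout : ∀ j, HasIntegrator (Gout j) (-(1 / c j))) (i : Fin n) (l : Fin (n + 3)) :
    ∃ f : ℝ, HasIntegrator (fun s => disturbancePlant Gin Gout s i l) f := by
  simp only [disturbancePlant, Matrix.of_apply]
  split_ifs
  · exact ⟨_, (hin i.castSucc).neg⟩
  · exact ⟨_, (hout i.castSucc).neg⟩
  · exact ⟨_, hout i.succ⟩
  · exact ⟨_, hout i.succ⟩
  · exact ⟨_, HasIntegrator.zero⟩

/-! ### Sequential loop closing -/

/-- The compensators of the first `m` loops of the design order, the others being switched off. -/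
def switchedOn (ν : Equiv.Perm (Fin n)) (C : Fin n → ℂ → ℂ) (m : ℕ) : Fin n → ℂ → ℂ :=
  fun j s => if (ν.symm j : ℕ) < m then C j s else 0

theorem inv_one_sub_mul {p q : Type*} [Fintype p] [DecidableEq p] [Fintype q] [DecidableEq q]
    (A : Matrix p q ℂ) (B : Matrix q p ℂ) (h : IsUnit (1 - A * B)) :
    (1 - A * B)⁻¹ = 1 + A * (1 - B * A)⁻¹ * B := by
  have hdet : IsUnit (1 - B * A).det := by
    rw [← Matrix.det_one_sub_mul_comm]
    exact (Matrix.isUnit_iff_isUnit_det _).1 h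
  refine Matrix.inv_eq_right_inv ?_
  have h1 : (1 - B * A) * (1 - B * A)⁻¹ = 1 := Matrix.mul_nonsing_inv _ hdet
  calc (1 - A * B) * (1 + A * (1 - B * A)⁻¹ * B)
      = 1 - A * B + A * ((1 - B * A) * (1 - B * A)⁻¹) * B := by
        simp only [Matrix.sub_mul, Matrix.mul_sub, Matrix.mul_add, Matrix.one_mul, Matrix.mul_one,
          Matrix.mul_assoc]
    _ = 1 := by rw [h1, Matrix.mul_one, sub_add_cancel]

/-- The partial plant inverts only the block of closed loops, while the induction uses the full-size
inverse. The push-through identity `inv_one_sub_mul` relates them, and column `ν m` is not masked at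
step `m`. -/
theorem stepPlant_eq {Gin Gout : Fin (n + 1) → ℂ → ℂ} {ν : Equiv.Perm (Fin n)}
    {C : Fin n → ℂ → ℂ} {m : Fin n} {s : ℂ}
    (h : IsUnit (loopMatrix Gin Gout (switchedOn ν C m) s)) :
    stepPlant Gin Gout ν C m s =
      ((loopMatrix Gin Gout (switchedOn ν C m) s)⁻¹ * plant Gin Gout s) (ν m) (ν m) := by
  let ι : {p : Fin n // p < m} → Fin n := fun p => ν p
  let D : Matrix {p : Fin n // p < m} {p : Fin n // p < m} ℂ :=
    Matrix.diagonal fun p => C (ι p) s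
  set G := plant Gin Gout s with hG
  let A := G.submatrix id ι * D
  let B := (1 : Matrix (Fin n) (Fin n) ℂ).submatrix ι id
  have hB : ∀ {κ : Type} (X : Matrix (Fin n) κ ℂ), B * X = X.submatrix ι id := by
    intro κ X
    ext p l
    simp [B, Matrix.mul_apply, Matrix.one_apply]
  -- `A` holds the closed columns with their compensators and `B` selects the closed rows, so `A *
  -- B` is the full feedback term and `B * A` its block.
  have hAB : loopMatrix Gin Gout (switchedOn ν C m) s = 1 - A * B := by
    rw [loopMatrix, ← hG]
    congr 1
    ext k l
    rw [Matrix.mul_diagonal, Matrix.mul_apply]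
    simp only [A, B, D, Matrix.mul_diagonal, Matrix.submatrix_apply, id, Matrix.one_apply,
      switchedOn, mul_ite, mul_one, mul_zero]
    by_cases hl : ν.symm l < m
    · rw [if_pos (by exact_mod_cast hl), Finset.sum_eq_single ⟨ν.symm l, hl⟩]
      · simp [ι]
      · intro p _ hp
        rw [if_neg]
        rintro rfl
        exact hp (by simp [ι])
      · simp
    · rw [if_neg (by exact_mod_cast hl), Finset.sum_eq_zero]
      intro p _
      rw [if_neg]
      rintro rfl
      exact hl (by simpa [ι] using p.2)
  rw [hAB] at h ⊢
  have hBA : B * A = G.submatrix ι ι * D := by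
    rw [← Matrix.mul_assoc, hB]
    rfl
  rw [inv_one_sub_mul A B h, Matrix.add_mul, Matrix.one_mul, Matrix.mul_assoc _ B, hBA, hB]
  change (maskedPlant Gin Gout ν m s + A * (1 - G.submatrix ι ι * D)⁻¹ *
    (maskedPlant Gin Gout ν m s).submatrix ι id) (ν m) (ν m) = _
  have hcol : ∀ k, maskedPlant Gin Gout ν m s k (ν m) = G k (ν m) := by
    intro k
    simp [maskedPlant, hG]
  rw [Matrix.add_apply, Matrix.add_apply, hcol, Matrix.mul_apply, Matrix.mul_apply]
  simp only [Matrix.submatrix_apply, id, hcol]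

theorem loopMatrix_succ (Gin Gout : Fin (n + 1) → ℂ → ℂ) (ν : Equiv.Perm (Fin n))
    (C : Fin n → ℂ → ℂ) (m : Fin n) (s : ℂ) :
    loopMatrix Gin Gout (switchedOn ν C (m + 1)) s =
      loopMatrix Gin Gout (switchedOn ν C m) s -
        plant Gin Gout s * Matrix.diagonal (Pi.single (ν m) (C (ν m) s)) := by
  rw [loopMatrix, loopMatrix, sub_sub, ← Matrix.mul_add, Matrix.diagonal_add]
  congr 3
  ext j
  simp only [switchedOn]
  by_cases hj : j = ν m
  · subst hj
    simp
  · have : ν.symm j ≠ m := fun h => hj (by rw [← h, Equiv.apply_symm_apply])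
    have h2 : (ν.symm j : ℕ) ≠ m := fun h => this (Fin.ext h)
    rw [Pi.single_eq_of_ne hj, add_zero]
    have : (ν.symm j : ℕ) < m + 1 ↔ (ν.symm j : ℕ) < m := by omega
    simp [this]

/-- State of the design after the first `m` loops have been closed. -/
theorem sequentialDesign_invariant {Gin Gout : Fin (n + 1) → ℂ → ℂ} {c : Fin (n + 1) → ℝ}
    (hc : ∀ j, 0 < c j) (hin : ∀ j, HasIntegrator (Gin j) (1 / c j))
    (hout : ∀ j, HasIntegrator (Gout j) (-(1 / c j))) (ν : Equiv.Perm (Fin n))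
    (C : Fin n → ℂ → ℂ) (m : ℕ) (hm : m ≤ n)
    (h : ∀ p : Fin n, (p : ℕ) < m → IsPI (C (ν p)) ∧
      ClosedLoopStable (stepPlant Gin Gout ν C p) (C (ν p))) :
    (∀ s : ℂ, 0 ≤ s.re → s ≠ 0 → IsUnit (loopMatrix Gin Gout (switchedOn ν C m) s)) ∧
    ∃ (g : Matrix (Fin n) (Fin n) ℝ) (f : Matrix (Fin n) (Fin (n + 3)) ℝ),
      PositiveOff (fun j => (ν.symm j : ℕ) < m) g ∧
      IntegratorMatrix (fun j => (ν.symm j : ℕ) < m)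
        (fun s => (loopMatrix Gin Gout (switchedOn ν C m) s)⁻¹ * plant Gin Gout s) g ∧
      IntegratorMatrix (fun j => (ν.symm j : ℕ) < m)
        (fun s => (loopMatrix Gin Gout (switchedOn ν C m) s)⁻¹ * disturbancePlant Gin Gout s) f := by
  induction m with
  | zero =>
    have e : ∀ s, loopMatrix Gin Gout (switchedOn ν C 0) s = 1 := by
      intro s
      simp [loopMatrix, switchedOn]
    choose f hf using disturbancePlant_integrator hin hout
    simp only [e, inv_one, Matrix.one_mul, Nat.not_lt_zero]
    exact ⟨fun s _ _ => isUnit_one, plantGain c, Matrix.of f, plantGain_positive hc,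
      ⟨plant_integrator hin hout, fun _ _ => False.elim, fun _ _ => False.elim⟩,
      ⟨hf, fun _ _ => False.elim, fun _ _ => False.elim⟩⟩
  | succ m ih =>
    obtain ⟨hU, g, f, hpos, hH, hF⟩ := ih (by omega) fun p hp => h p (by omega)
    obtain ⟨M, rfl⟩ : ∃ M : Fin n, (M : ℕ) = m := ⟨⟨m, by omega⟩, rfl⟩
    obtain ⟨hPI, hst⟩ := h M (by omega)
    have hclosed : (fun j => (ν.symm j : ℕ) < M + 1) =
        fun j => (ν.symm j : ℕ) < M ∨ j = ν M := by
      ext j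
      rw [Nat.lt_succ_iff_lt_or_eq, ← Fin.ext_iff, Equiv.symm_apply_eq]
    have hopen : ¬ (ν.symm (ν M) : ℕ) < M := by simp
    set H : ℂ → Matrix (Fin n) (Fin n) ℂ := fun s =>
      (loopMatrix Gin Gout (switchedOn ν C M) s)⁻¹ * plant Gin Gout s with hHdef
    have hst' : ClosedLoopStable (fun s => H s (ν M) (ν M)) (C (ν M)) := by
      exact hst.congr fun s hs h0 => (stepPlant_eq (hU s hs h0)).symm
    have hg := (hpos.diag_pos hopen).ne'
    -- Well-posedness of the scalar loop is precisely the nonvanishing denominator of the rank-one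
    -- update.
    have hstep := fun (s : ℂ) (hs : 0 ≤ s.re) (h0 : s ≠ 0) =>
      isUnit_sub_mul_single (hU s hs h0) (ν M) (hst'.1 s hs h0)
    rw [hclosed]
    refine ⟨fun s hs h0 => ?_, _, _, hpos.schur hopen,
      hH.close hH hg hPI hst' fun s hs h0 k l => ?_, hH.close hF hg hPI hst' fun s hs h0 k l => ?_⟩
    · rw [loopMatrix_succ]
      exact (hstep s hs h0).1
    · simp only [loopMatrix_succ]
      exact (hstep s hs h0).2 _ k l
    · simp only [loopMatrix_succ]
      exact (hstep s hs h0).2 _ k l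

end Design

/-! ### Step responses and uniqueness of the time-domain output -/

theorem real_Iic_eq_integral (μ : Measure ℝ) (t : ℝ) :
    μ.real (Iic t) = ∫ τ, (Iic t).indicator (fun _ => (1 : ℝ)) τ ∂μ := by
  rw [integral_indicator measurableSet_Iic]
  simp

theorem continuousWithinAt_real_Iic (μ : Measure ℝ) [IsFiniteMeasure μ] (t : ℝ) :
    ContinuousWithinAt (fun t => μ.real (Iic t)) (Ici t) t := by
  simp only [real_Iic_eq_integral]
  refine continuousWithinAt_of_dominated (bound := fun _ => 1)
    (Eventually.of_forall fun u => ?_) (Eventually.of_forall fun u => Eventually.of_forall fun τ => ?_)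
    (integrable_const _) (Eventually.of_forall fun τ => ?_)
  · exact (measurable_const.indicator measurableSet_Iic).aestronglyMeasurable
  · by_cases h : τ ∈ Iic u <;> simp [h]
  · rcases le_or_gt τ t with h | h
    · refine (continuousWithinAt_const (b := (1 : ℝ))).congr (fun u hu => ?_) ?_
      · rw [indicator_of_mem]
        exact h.trans hu
      · rw [indicator_of_mem]
        exact h
    · refine ContinuousAt.continuousWithinAt ?_
      refine (continuousAt_const (y := (0 : ℝ))).congr ?_
      filter_upwards [Iio_mem_nhds h] with u hu
      rw [indicator_of_notMem]
      exact not_le.2 (mem_Iio.1 hu)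

/-- The distribution function of `μ` is the step response: its Laplace transform is that of `μ`
divided by `s`. -/
theorem laplace_real_Iic {μ : Measure ℝ} [IsFiniteMeasure μ] (h0 : μ (Iio 0) = 0) {s : ℂ}
    (hs : 0 < s.re) :
    IntegrableOn (fun t : ℝ => Complex.exp (-s * (t : ℂ)) * (μ.real (Iic t) : ℂ)) (Ioi 0) ∧
    ∫ t in Ioi (0 : ℝ), Complex.exp (-s * (t : ℂ)) * (μ.real (Iic t) : ℂ) = laplace μ s / s := by
  have hre : (-s).re < 0 := by simpa using hs
  let f : ℝ → ℝ → ℂ := fun t τ =>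
    Complex.exp (-s * (t : ℂ)) * (Iic t).indicator (fun _ => (1 : ℂ)) τ
  have hmeas : Measurable fun p : ℝ × ℝ => (Iic p.1).indicator (fun _ => (1 : ℂ)) p.2 := by
    have : (fun p : ℝ × ℝ => (Iic p.1).indicator (fun _ => (1 : ℂ)) p.2) =
        {p : ℝ × ℝ | p.2 ≤ p.1}.indicator fun _ => 1 := by
      ext p
      simp [indicator_apply]
    rw [this]
    exact measurable_const.indicator (measurableSet_le measurable_snd measurable_fst)
  have hexp : Integrable (fun t : ℝ => Complex.exp (-s * (t : ℂ))) (volume.restrict (Ioi 0)) :=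
    integrableOn_exp_mul_complex_Ioi hre 0
  have hfint : Integrable (Function.uncurry f) ((volume.restrict (Ioi (0 : ℝ))).prod μ) := by
    refine (hexp.comp_fst μ).mono ?_ (Eventually.of_forall fun p => ?_)
    · refine Measurable.aestronglyMeasurable ?_
      exact (by fun_prop : Measurable fun p : ℝ × ℝ => Complex.exp (-s * (p.1 : ℂ))).mul hmeas
    · simp only [Function.uncurry, f, norm_mul]
      refine mul_le_of_le_one_right (norm_nonneg _) ?_
      by_cases h : p.2 ∈ Iic p.1 <;> simp [h]
  have hinner : ∀ t : ℝ, ∫ τ, f t τ ∂μ = Complex.exp (-s * (t : ℂ)) * (μ.real (Iic t) : ℂ) := by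
    intro t
    simp only [f]
    rw [integral_const_mul, integral_indicator measurableSet_Iic]
    simp
  constructor
  · have := hfint.integral_prod_left
    simp only [Function.uncurry, hinner] at this
    exact this
  · simp only [← hinner]
    -- By Fubini, each point mass at `τ` contributes the transform of a unit step delayed by `τ`.
    rw [integral_integral_swap hfint, laplace, ← integral_div]
    refine integral_congr_ae ?_
    filter_upwards [ae_nonneg h0] with τ hτ
    have e : ∀ t : ℝ, f t τ = (Ici τ).indicator (fun t : ℝ => Complex.exp (-s * (t : ℂ))) t := by
      intro t
      by_cases h : τ ≤ t <;> simp [f, h]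
    simp only [e]
    rw [setIntegral_indicator measurableSet_Ici, setIntegral_congr_set (t := Ioi τ),
      integral_exp_mul_complex_Ioi hre, neg_div_neg_eq]
    rcases hτ.eq_or_lt with rfl | h
    · rw [inter_eq_left.2 Ioi_subset_Ici_self]
      exact ae_eq_refl _
    · have : Ioi 0 ∩ Ici τ = Ici τ := inter_eq_right.2 fun x hx => h.trans_le hx
      rw [this]
      exact Ioi_ae_eq_Ici.symm

theorem tendsto_laplace_zero {μ : Measure ℝ} [IsFiniteMeasure μ] (h0 : μ (Iio 0) = 0) :
    Tendsto (fun x : ℝ => laplace μ x) (𝓝[>] 0) (𝓝 (μ.real univ : ℂ)) := by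
  have e : (μ.real univ : ℂ) = ∫ _, (1 : ℂ) ∂μ := by simp
  rw [e]
  refine tendsto_integral_filter_of_dominated_convergence (fun _ => 1)
    (Eventually.of_forall fun x => by fun_prop) ?_ (integrable_const _)
    (Eventually.of_forall fun t => ?_)
  · filter_upwards [self_mem_nhdsWithin] with x hx
    have hx : 0 < x := hx
    filter_upwards [ae_nonneg h0] with t ht
    simpa using norm_exp_le le_rfl (s := (x : ℂ)) (by simpa using hx.le) ht
  · have : Continuous fun x : ℝ => Complex.exp (-(x : ℂ) * (t : ℂ)) := by fun_prop
    have := this.tendsto 0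
    simp only [Complex.ofReal_zero, neg_zero, zero_mul, Complex.exp_zero] at this
    exact this.mono_left nhdsWithin_le_nhds

/-- Step response of a stable transfer function with a zero at the origin. -/
theorem Stable.exists_stepResponse {F : ℂ → ℂ} (hF : Stable F)
    (h0 : Tendsto F (𝓝[{s : ℂ | 0 < s.re}] 0) (𝓝 0)) :
    ∃ y : ℝ → ℝ, (∀ t, ContinuousWithinAt y (Ici t) t) ∧ Tendsto y atTop (𝓝 0) ∧
      ∀ s : ℂ, 0 < s.re →
        IntegrableOn (fun t : ℝ => Complex.exp (-s * (t : ℂ)) * (y t : ℂ)) (Ioi 0) ∧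
        ∫ t in Ioi (0 : ℝ), Complex.exp (-s * (t : ℂ)) * (y t : ℂ) = F s / s := by
  obtain ⟨ε, hε, M, μ₁, μ₂, h1, h2, hM, hF⟩ := hF.exists_stableWith
  obtain ⟨f1, f2⟩ := weightedMass_ne_top hM
  have := isFiniteMeasure_of_weightedMass hε.le h1 f1
  have := isFiniteMeasure_of_weightedMass hε.le h2 f2
  refine ⟨fun t => μ₁.real (Iic t) - μ₂.real (Iic t), fun t =>
    (continuousWithinAt_real_Iic μ₁ t).sub (continuousWithinAt_real_Iic μ₂ t), ?_, fun s hs => ?_⟩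
  · have lim : ∀ μ : Measure ℝ, IsFiniteMeasure μ →
        Tendsto (fun t => μ.real (Iic t)) atTop (𝓝 (μ.real univ)) := fun μ _ =>
      (ENNReal.tendsto_toReal (measure_ne_top μ _)).comp (tendsto_measure_Iic_atTop μ)
    have hl := (lim μ₁ inferInstance).sub (lim μ₂ inferInstance)
    -- As `s` decreases to zero along the reals, `F s` tends to the signed total mass, so the zero
    -- at the origin forces this mass to vanish.
    have hz : μ₁.real univ - μ₂.real univ = 0 := by
      have t1 := (tendsto_laplace_zero h1).sub (tendsto_laplace_zero h2)
      have hx : Tendsto (fun x : ℝ => (x : ℂ)) (𝓝[>] 0) (𝓝[{s : ℂ | 0 < s.re}] 0) := by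
        refine tendsto_nhdsWithin_iff.2 ⟨?_, ?_⟩
        · exact (Complex.continuous_ofReal.tendsto 0).mono_left nhdsWithin_le_nhds
        · filter_upwards [self_mem_nhdsWithin] with x hx
          simpa using hx
      have t2 : Tendsto (fun x : ℝ => laplace μ₁ x - laplace μ₂ x) (𝓝[>] 0) (𝓝 0) := by
        refine (h0.comp hx).congr' ?_
        filter_upwards [self_mem_nhdsWithin] with x hx
        have hx : 0 < x := hx
        exact hF x (by simpa using hx.le) (by simpa using hx.ne')
      have := tendsto_nhds_unique t1 t2
      exact_mod_cast this
    rwa [hz] at hl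
  · obtain ⟨i1, v1⟩ := laplace_real_Iic h1 hs
    obtain ⟨i2, v2⟩ := laplace_real_Iic h2 hs
    have e : (fun t : ℝ => Complex.exp (-s * (t : ℂ)) *
        ((μ₁.real (Iic t) - μ₂.real (Iic t) : ℝ) : ℂ)) = fun t : ℝ =>
        Complex.exp (-s * (t : ℂ)) * (μ₁.real (Iic t) : ℂ) -
          Complex.exp (-s * (t : ℂ)) * (μ₂.real (Iic t) : ℂ) := by
      ext t
      push_cast
      ring
    have hs0 : s ≠ 0 := by
      rintro rfl
      simp at hs
    rw [e]
    refine ⟨i1.sub i2, ?_⟩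
    rw [integral_sub i1 i2, v1, v2, hF s hs.le hs0]
    ring

/-- A function on the half-line whose Fourier transform vanishes is zero almost everywhere. -/
theorem ae_eq_zero_of_fourier_eq_zero {μ : Measure ℝ} [SFinite μ] {v : ℝ → ℝ} (hv : Integrable v μ)
    (h : ∀ ω : ℝ, ∫ t, Complex.exp ((ω * t : ℝ) * Complex.I) * (v t : ℂ) ∂μ = 0) :
    v =ᵐ[μ] 0 := by
  have m1 : AEMeasurable (fun t => ENNReal.ofReal (v t)) μ := hv.1.aemeasurable.ennreal_ofReal
  have m2 : AEMeasurable (fun t => ENNReal.ofReal (-v t)) μ :=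
    hv.1.aemeasurable.neg.ennreal_ofReal
  have := isFiniteMeasure_withDensity_ofReal hv.2
  have := isFiniteMeasure_withDensity_ofReal hv.neg.2
  have fin2 : IsFiniteMeasure (μ.withDensity fun t => ENNReal.ofReal (-v t)) := this
  have i : ∀ ω : ℝ, ∀ w : ℝ → ℝ, Integrable w μ →
      Integrable (fun t => ((ENNReal.ofReal (w t)).toReal : ℝ) •
        Complex.exp ((ω * t : ℝ) * Complex.I)) μ := by
    intro ω w hw
    have : Integrable (fun t => ((max (w t) 0 : ℝ) : ℂ)) μ := (hw.pos_part).ofReal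
    refine (this.mul_bdd (c := 1) (f := fun t => ((max (w t) 0 : ℝ) : ℂ))
      (g := fun t : ℝ => Complex.exp ((ω * t : ℝ) * Complex.I))
      (by fun_prop) (Eventually.of_forall fun t => ?_)).congr (Eventually.of_forall fun t => ?_)
    · rw [Complex.norm_exp_ofReal_mul_I]
    · simp [ENNReal.toReal_ofReal']
  -- The positive and negative parts of `v` give finite measures with the same characteristic
  -- function.
  have key : μ.withDensity (fun t => ENNReal.ofReal (v t)) =
      μ.withDensity (fun t => ENNReal.ofReal (-v t)) := by
    refine Measure.ext_of_charFun (funext fun ω => ?_)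
    rw [charFun_apply_real, charFun_apply_real,
      integral_withDensity_eq_integral_toReal_smul₀ m1 (by simp),
      integral_withDensity_eq_integral_toReal_smul₀ m2 (by simp), ← sub_eq_zero]
    have i1 := i ω v hv
    have i2 := i ω (fun t => -v t) hv.neg
    simp only [Complex.ofReal_mul] at i1 i2
    rw [← integral_sub i1 i2, ← h ω]
    refine integral_congr_ae (Eventually.of_forall fun t => ?_)
    beta_reduce
    rw [← sub_smul, ENNReal.toReal_ofReal', ENNReal.toReal_ofReal', Complex.real_smul, mul_comm,
      Complex.ofReal_mul]
    congr 2
    rcases le_total 0 (v t) with h | h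
    · rw [max_eq_left h, max_eq_right (by linarith), sub_zero]
    · rw [max_eq_right h, max_eq_left (by linarith)]
      ring
  have hae := (withDensity_eq_iff m1 m2 ((lintegral_ofReal_le_lintegral_enorm v).trans_lt
    hv.2).ne).1 key
  filter_upwards [hae] with t ht
  rcases lt_trichotomy (v t) 0 with h | h | h
  · rw [ENNReal.ofReal_of_nonpos h.le, eq_comm, ENNReal.ofReal_eq_zero] at ht
    linarith
  · exact h
  · rw [ENNReal.ofReal_of_nonpos (by linarith : -v t ≤ 0), ENNReal.ofReal_eq_zero] at ht
    linarith

/-- Every interval to the right of `t` has positive measure, so zeros of `u` accumulate at `t` from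
the right. -/
theorem eq_zero_of_ae_of_rightContinuous {u : ℝ → ℝ}
    (hu : ∀ t, 0 ≤ t → ContinuousWithinAt u (Ici t) t)
    (h : ∀ᵐ t ∂(volume.restrict (Ioi (0 : ℝ))), u t = 0) {t : ℝ} (ht : 0 ≤ t) : u t = 0 := by
  have hfr : ∃ᶠ x in 𝓝[>] t, u x = 0 := by
    intro hev
    obtain ⟨b, hb, hsub⟩ := mem_nhdsGT_iff_exists_Ioo_subset.1 hev
    rw [ae_restrict_iff' measurableSet_Ioi, ae_iff] at h
    have h1 : volume (Ioo t b) = 0 := by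
      refine measure_mono_null (fun x hx => ?_) h
      have hne : ¬ u x = 0 := hsub hx
      exact fun hh => hne (hh (ht.trans_lt hx.1))
    rw [Real.volume_Ioo, ENNReal.ofReal_eq_zero] at h1
    have hb : t < b := hb
    linarith
  have hlim : Tendsto u (𝓝[>] t) (𝓝 (u t)) := (hu t ht).mono_left (nhdsWithin_mono _ Ioi_subset_Ici_self)
  have := isClosed_singleton (x := (0 : ℝ))
  exact this.mem_of_frequently_of_tendsto hfr hlim

/-- Right-continuous functions on the half-line are determined by their Laplace transforms. -/
theorem eq_of_laplace_eq {y z : ℝ → ℝ} {σ : ℝ}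
    (hy : ∀ t, 0 ≤ t → ContinuousWithinAt y (Ici t) t)
    (hz : ∀ t, 0 ≤ t → ContinuousWithinAt z (Ici t) t)
    (iy : ∀ s : ℂ, σ < s.re →
      IntegrableOn (fun t : ℝ => Complex.exp (-s * (t : ℂ)) * (y t : ℂ)) (Ioi 0))
    (iz : ∀ s : ℂ, σ < s.re →
      IntegrableOn (fun t : ℝ => Complex.exp (-s * (t : ℂ)) * (z t : ℂ)) (Ioi 0))
    (h : ∀ s : ℂ, σ < s.re → ∫ t in Ioi (0 : ℝ), Complex.exp (-s * (t : ℂ)) * (y t : ℂ) =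
      ∫ t in Ioi (0 : ℝ), Complex.exp (-s * (t : ℂ)) * (z t : ℂ)) {t : ℝ} (ht : 0 ≤ t) :
    y t = z t := by
  -- On the line `re s = a` the Laplace transform is a Fourier transform of the function damped by
  -- `exp (-a t)`, which is integrable.
  set a : ℝ := σ + 1 with ha
  have hv : Integrable (fun t => Real.exp (-a * t) * (y t - z t)) (volume.restrict (Ioi 0)) := by
    have h1 := ((iy a (by simp [ha])).sub (iz a (by simp [ha]))).re
    refine h1.congr (Eventually.of_forall fun t => ?_)
    have : Complex.exp (-(a : ℂ) * t) * (y t : ℂ) - Complex.exp (-(a : ℂ) * t) * (z t : ℂ) =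
        ((Real.exp (-a * t) * (y t - z t) : ℝ) : ℂ) := by
      push_cast
      ring
    simp only [Pi.sub_apply, this]
    exact Complex.ofReal_re _
  have hzero := ae_eq_zero_of_fourier_eq_zero hv fun ω => by
    have hs : σ < ((a : ℂ) - ω * Complex.I).re := by simp [ha]
    have h2 := sub_eq_zero.2 (h _ hs)
    rw [← integral_sub (iy _ hs) (iz _ hs)] at h2
    rw [← h2]
    refine integral_congr_ae (Eventually.of_forall fun t => ?_)
    have e : Complex.exp (-((a : ℂ) - ω * Complex.I) * t) =
        Complex.exp ((ω * t : ℝ) * Complex.I) * Complex.exp (-(a : ℂ) * t) := by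
      rw [← Complex.exp_add]
      congr 1
      push_cast
      ring
    beta_reduce
    rw [e]
    push_cast
    ring
  have := eq_zero_of_ae_of_rightContinuous (u := fun t => y t - z t)
    (fun t ht => (hy t ht).sub (hz t ht)) (by
      filter_upwards [hzero] with t ht
      simpa [(Real.exp_pos _).ne'] using ht) ht
  exact sub_eq_zero.1 this

theorem Stable.tendsto_zero_of_div {F : ℂ → ℂ} (h : Stable (fun s => F s / s)) :
    Tendsto F (𝓝[{s : ℂ | 0 < s.re}] 0) (𝓝 0) := by
  obtain ⟨M, -, hM⟩ := h.exists_norm_le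
  have h1 : Tendsto (fun s : ℂ => M * ‖s‖) (𝓝[{s : ℂ | 0 < s.re}] 0) (𝓝 0) := by
    have : Continuous fun s : ℂ => M * ‖s‖ := by fun_prop
    have := this.tendsto 0
    rw [norm_zero, mul_zero] at this
    exact this.mono_left nhdsWithin_le_nhds
  refine squeeze_zero_norm' ?_ h1
  filter_upwards [self_mem_nhdsWithin] with s hs
  have hs : 0 < s.re := hs
  have hs0 : s ≠ 0 := by
    rintro rfl
    simp at hs
  have := hM s hs.le hs0
  rwa [norm_div, div_le_iff₀ (norm_pos_iff.2 hs0)] at this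

/-! ### Feasibility of each step and disturbance rejection -/

theorem stepPlant_integrator {n : ℕ} {Gin Gout : Fin (n + 1) → ℂ → ℂ} {c : Fin (n + 1) → ℝ}
    (hc : ∀ j, 0 < c j) (hin : ∀ j, HasIntegrator (Gin j) (1 / c j))
    (hout : ∀ j, HasIntegrator (Gout j) (-(1 / c j))) (ν : Equiv.Perm (Fin n))
    (C : Fin n → ℂ → ℂ) (m : Fin n)
    (h : ∀ p : Fin n, p < m → IsPI (C (ν p)) ∧
      ClosedLoopStable (stepPlant Gin Gout ν C p) (C (ν p))) :
    ∃ g : ℝ, 0 < g ∧ HasIntegrator (stepPlant Gin Gout ν C m) g := by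
  obtain ⟨hU, g, f, hpos, hH, -⟩ :=
    sequentialDesign_invariant hc hin hout ν C m m.2.le fun p hp => h p hp
  exact ⟨g (ν m) (ν m), hpos.diag_pos (by simp),
    (hH.integrator (ν m) (ν m)).congr fun s hs h0 => stepPlant_eq (hU s hs h0)⟩

/-- All loops closed: the multivariable loop is well posed, and its disturbance responses are stable
with a zero at the origin. -/
theorem closedLoop_stable {n : ℕ} {Gin Gout : Fin (n + 1) → ℂ → ℂ} {c : Fin (n + 1) → ℝ}
    (hc : ∀ j, 0 < c j) (hin : ∀ j, HasIntegrator (Gin j) (1 / c j))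
    (hout : ∀ j, HasIntegrator (Gout j) (-(1 / c j))) (ν : Equiv.Perm (Fin n))
    (C : Fin n → ℂ → ℂ)
    (h : ∀ p : Fin n, IsPI (C (ν p)) ∧
      ClosedLoopStable (stepPlant Gin Gout ν C p) (C (ν p))) :
    (∀ s : ℂ, 0 ≤ s.re → s ≠ 0 → IsUnit (loopMatrix Gin Gout C s)) ∧
    ∀ k l, Stable (fun s => closedLoop Gin Gout C s k l) ∧
      Stable (fun s => closedLoop Gin Gout C s k l / s) := by
  obtain ⟨hU, g, f, -, -, hF⟩ :=
    sequentialDesign_invariant hc hin hout ν C n le_rfl fun p _ => h p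
  have e : switchedOn ν C n = C := by
    ext j s
    simp [switchedOn]
  rw [e] at hU hF
  refine ⟨hU, fun k l => ⟨?_, hF.stable_div k l (ν.symm k).2⟩⟩
  have := hF.integrator k l
  rw [hF.gain_eq_zero k l (ν.symm k).2, hasIntegrator_zero_iff] at this
  exact this

theorem outputHat_apply {n : ℕ} (Gin Gout : Fin (n + 1) → ℂ → ℂ) (C : Fin n → ℂ → ℂ)
    (d : Fin (n + 3) → ℝ) (s : ℂ) (k : Fin n) :
    outputHat Gin Gout C d s k = (∑ l, (d l : ℂ) * closedLoop Gin Gout C s k l) / s := by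
  rw [outputHat, Matrix.mulVec, dotProduct, Finset.sum_div]
  refine Finset.sum_congr rfl fun l _ => ?_
  ring

/-- Constant disturbances are rejected. -/
theorem disturbance_rejection {n : ℕ} {Gin Gout : Fin (n + 1) → ℂ → ℂ} {C : Fin n → ℂ → ℂ}
    (h : ∀ k l, Stable (fun s => closedLoop Gin Gout C s k l) ∧
      Stable (fun s => closedLoop Gin Gout C s k l / s)) (d : Fin (n + 3) → ℝ) :
    Tendsto (fun s : ℂ => s • outputHat Gin Gout C d s) (𝓝[{s : ℂ | 0 < s.re}] 0) (𝓝 0) ∧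
    (∃ y, IsTimeOutput (outputHat Gin Gout C d) y) ∧
    ∀ y, IsTimeOutput (outputHat Gin Gout C d) y → Tendsto y atTop (𝓝 0) := by
  let F : Fin n → ℂ → ℂ := fun k s => ∑ l, (d l : ℂ) * closedLoop Gin Gout C s k l
  have hF : ∀ k, Stable (F k) := fun k =>
    Stable.sum Finset.univ fun l _ => (h k l).1.const_mul (d l)
  have hF0 : ∀ k, Tendsto (F k) (𝓝[{s : ℂ | 0 < s.re}] 0) (𝓝 0) := fun k =>
    Stable.tendsto_zero_of_div <|
      (Stable.sum Finset.univ fun l _ => (h k l).2.const_mul (d l)).congr fun s _ _ => by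
        rw [Finset.sum_div]
        exact Finset.sum_congr rfl fun l _ => mul_div_assoc _ _ _
  choose y hyc hylim hyL using fun k => (hF k).exists_stepResponse (hF0 k)
  refine ⟨?_, ⟨fun t k => y k t, fun t _ => ?_, 0, le_rfl, fun s hs k => ?_⟩, fun x hx => ?_⟩
  · rw [tendsto_pi_nhds]
    intro k
    refine (hF0 k).congr' ?_
    filter_upwards [self_mem_nhdsWithin] with s hs
    have hs0 : s ≠ 0 := by
      rintro rfl
      simp at hs
    rw [Pi.smul_apply, outputHat_apply, smul_eq_mul, mul_div_cancel₀ _ hs0]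
  · exact continuousWithinAt_pi.2 fun k => hyc k t
  · rw [outputHat_apply]
    exact hyL k s hs
  · obtain ⟨hxc, σ, hσ, hxL⟩ := hx
    rw [tendsto_pi_nhds]
    intro k
    refine (hylim k).congr' ?_
    filter_upwards [eventually_ge_atTop 0] with t ht
    -- The given output has its transform only for `re s > σ`; since `0 ≤ σ`, the constructed step
    -- response has the same transform there.
    refine eq_of_laplace_eq (σ := σ) (fun t _ => hyc k t)
      (fun t ht => continuousWithinAt_pi.1 (hxc t ht) k)
      (fun s hs => (hyL k s (hσ.trans_lt hs)).1) (fun s hs => (hxL s hs k).1) (fun s hs => ?_) ht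
    rw [(hyL k s (hσ.trans_lt hs)).2, (hxL s hs k).2, outputHat_apply]

end Channel

end

theorem theorem1 {n : ℕ} (Gin Gout : Fin (n + 1) → ℂ → ℂ) (c : Fin (n + 1) → ℝ)
    (hc : ∀ j, 0 < c j)
    (hin : ∀ j, Channel.HasIntegrator (Gin j) (1 / c j))
    (hout : ∀ j, Channel.HasIntegrator (Gout j) (-(1 / c j)))
    (ν : Equiv.Perm (Fin n)) (φ : ℝ) (hφ₀ : 0 < φ) (hφ₁ : φ < 90) :
    -- every step of the procedure is feasible, whatever stabilizing compensators were chosen before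
    (∀ (m : Fin n) (C : Fin n → ℂ → ℂ),
      (∀ p : Fin n, p < m → Channel.IsPI (C (ν p)) ∧
        Channel.ClosedLoopStable (Channel.stepPlant Gin Gout ν C p) (C (ν p))) →
      ∃ Cm : ℂ → ℂ, Channel.IsPI Cm ∧
        Channel.ClosedLoopStable (Channel.stepPlant Gin Gout ν C m) Cm ∧
        Channel.HasPhaseMargin (Channel.stepPlant Gin Gout ν C m) Cm φ) ∧
    -- every outcome of the procedure stabilizes the MIMO loop and rejects constant disturbances
    (∀ C : Fin n → ℂ → ℂ,
      (∀ m : Fin n, Channel.IsPI (C (ν m)) ∧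
        Channel.ClosedLoopStable (Channel.stepPlant Gin Gout ν C m) (C (ν m))) →
      (∀ s : ℂ, 0 ≤ s.re → s ≠ 0 → IsUnit (Channel.loopMatrix Gin Gout C s)) ∧
      (∀ k l, Channel.Stable (fun s => Channel.closedLoop Gin Gout C s k l)) ∧
      ∀ d : Fin (n + 3) → ℝ,
        Filter.Tendsto (fun s : ℂ => s • Channel.outputHat Gin Gout C d s)
          (nhdsWithin 0 {s : ℂ | 0 < s.re}) (nhds 0) ∧
        (∃ y, Channel.IsTimeOutput (Channel.outputHat Gin Gout C d) y) ∧
        ∀ y, Channel.IsTimeOutput (Channel.outputHat Gin Gout C d) y →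
          Filter.Tendsto y Filter.atTop (nhds 0)) := by
  refine ⟨fun m C h => ?_, fun C h => ?_⟩
  · obtain ⟨g, hg, hP⟩ := Channel.stepPlant_integrator hc hin hout ν C m h
    exact Channel.exists_PI_phaseMargin hg hP hφ₀ hφ₁
  · obtain ⟨hU, hS⟩ := Channel.closedLoop_stable hc hin hout ν C h
    exact ⟨hU, fun k l => (hS k l).1, Channel.disturbance_rejection hS⟩
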